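/- A (labelled) multigraph $G$ with vertex set $\{1,\dots,n\}$ and $m$ edges is a multiset of $m$ unordered pairs $\{u,v\}$ of not necessarily distinct vertices (loops and multiple edges are allowed). Its compensation factor is $\kappa(G)=\frac{\operatorname{seqv}(G)}{2^m\,m!}$, where $\operatorname{seqv}(G)$ is the number of sequences $(u_1,v_1,\dots,u_m,v_m)\in\{1,\dots,n\}^{2m}$ such that $\{u_1,v_1\},\dots,\{u_m,v_m\}$ is, as a multiset, the edge multiset of $G$. The number $C_{m,n}$ of connected multigraphs with $n$ vertices and $m$ edges is defined as the sum of $\kappa(G)$ over all connected multigraphs $G$ with vertex set $\{1,\dots,n\}$ and $m$ edges. **Theorem.** Let $r\ge -1$ be a fixed integer. Then, as $n\to\infty$ with $m=n+r$, $$C_{m,n}\sim K_r\, n^{\,n+\frac{3r-1}{2}},$$ where $$K_r=\begin{cases}1 & \text{if } r=-1,\\[2pt] \dfrac{\sqrt{2\pi}}{4} & \text{if } r=0,\\[6pt] \dfrac{\sqrt{2\pi}}{2^{3r/2}\,\Gamma(3r/2)}\,[v^{2r}]\log\left(\displaystyle\sum_{\ell\ge 0}\frac{(6\ell)!}{288^{\ell}\,(3\ell)!}\,\frac{v^{2\ell}}{(2\ell)!}\right)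 & \text{if } r>0.\end{cases}$$ Here $[v^{2r}]$ denotes the coefficient of $v^{2r}$ and the logarithm is that of a formal power series with constant term $1$. -/

import Mathlib

open Filter Asymptotics

/-- A labelled multigraph with vertex set `Fin n` and `m` edges: a multiset of `m` unordered
pairs of (not necessarily distinct) vertices; loops and repeated edges are allowed. -/
abbrev Multigraph (n m : ℕ) : Type := Sym (Sym2 (Fin n)) m

namespace Multigraph

variable {n m : ℕ}

/-- The multigraph drawn by the sequence of vertices `u₁, v₁, …, uₘ, vₘ`. -/
def ofSeq (s : Fin m → Fin n × Fin n) : Multigraph n m :=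
  Sym.mk (Finset.univ.val.map fun i => s((s i).1, (s i).2)) (by simp)

/-- The number of sequences of `2 m` vertices that draw the multigraph `G`. -/
def seqv (G : Multigraph n m) : ℕ :=
  Fintype.card {s : Fin m → Fin n × Fin n // ofSeq s = G}

/-- The compensation factor `κ(G) = seqv(G) / (2 ^ m * m!)`. -/
noncomputable def kappa (G : Multigraph n m) : ℝ :=
  (seqv G : ℝ) / (2 ^ m * (m.factorial : ℝ))

/-- A multigraph is connected if it has at least one vertex and any two of its vertices are
joined by a path of edges (loops and multiplicities of edges play no role for this). -/
def IsConnected (G : Multigraph n m) : Prop :=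
  (SimpleGraph.fromEdgeSet {e : Sym2 (Fin n) | e ∈ G}).Connected

end Multigraph

open Classical in
/-- The number `C_{m,n}` of connected multigraphs with `n` vertices and `m` edges, that is, the
sum of their compensation factors. -/
noncomputable def connectedMultigraphNumber (m n : ℕ) : ℝ :=
  ∑ G : Multigraph n m with G.IsConnected, G.kappa

/-- The formal power series `∑_{ℓ ≥ 0} (6ℓ)! / (288 ^ ℓ (3ℓ)!) * v ^ (2ℓ) / (2ℓ)!`, the generating
function of cubic multigraphs. Its constant term is `1`. -/
noncomputable def cubicSeries : PowerSeries ℝ :=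
  PowerSeries.mk fun k =>
    if Even k then
      (((6 * (k / 2)).factorial : ℝ) / (288 ^ (k / 2) * ((3 * (k / 2)).factorial : ℝ)))
        / ((2 * (k / 2)).factorial : ℝ)
    else 0

/-- The constant `K_r` for `r ≥ -1` (the value for `r < -1` is irrelevant). -/
noncomputable def excessConstant (r : ℤ) : ℝ :=
  if r = -1 then 1
  else if r = 0 then Real.sqrt (2 * Real.pi) / 4
  else
    Real.sqrt (2 * Real.pi) /
        ((2 : ℝ) ^ (3 * (r : ℝ) / 2) * Real.Gamma (3 * (r : ℝ) / 2))
      * PowerSeries.coeff (2 * r.toNat) (PowerSeries.logOf cubicSeries)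

/-!
The weighted count `C_{m,n}` is `1 / (2 ^ m m!)` times the number of sequences of `m` ordered pairs
of vertices whose graph is connected (`connectedMultigraphNumber_eq`). Deleting the last edge of
such a sequence leaves either a connected graph or exactly two components, one around each end of
the edge; this gives Wright's quadratic recurrence `connectedMultigraphNumber_succ`.

Write `W_s` for the exponential generating function of the connected multigraphs of excess
`r = s - 1` and `D = z d/dz`. For `r = -1` the recurrence becomes the differential equation
`DT (1 - T) = T` of the rooted tree series `T = D W_0`, which determines the coefficients of all
powers of `T` (`coeff_rootedTreeSeries_pow`) and in particular Cayley's formula. With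
`x = 1 / (1 - T)` it also gives `D x = x ^ 3 - x ^ 2`, so that the coefficients of `x ^ (k + 2)`
follow from those of `x ^ k` and `x ^ (k + 1)`. Since `n! [z ^ n] x = n ^ n`, and since
`n! [z ^ n] x ^ 2` is an integral to which Laplace's method applies, this yields the asymptotics
of `n! [z ^ n] x ^ k` for every `k ≥ 1` (`tendsto_coeff_pathSeries_pow`).

For `r ≥ 0` the recurrence reads
`D W_{r+1} + r x W_{r+1} = x / 2 * (D² W_r + ∑ D W_{a+1} D W_{b+1})`, the sum being over
`a + b = r - 1`. By induction, `D W_{r+1} = d_r x ^ (3 r + 2)` up to an error whose coefficients are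
at most those of a multiple of `x ^ (3 r + 1)`, where the `d_r` satisfy a quadratic recurrence
(`eulerOp_excessSeries_sub_mem`). The series of cubic multigraphs satisfies a linear differential
equation of second order, hence its logarithmic derivative satisfies a Riccati equation; this is
the recurrence of the `d_r` once more, so `d_r = 3 r [v ^ (2 r)] log` of that series
for `r ≥ 1`, while `d_0 = 1 / 2` (`leadingConstant_succ`).
-/

/-! ### Deleting an edge from a connected graph -/

/-- The vertex set `A` induces a connected component of `G` that contains `a` but not `b`, and the
remaining vertices induce a connected graph as well. -/
structure SimpleGraph.Separates {V : Type*} (G : SimpleGraph V) (A : Set V) (a b : V) : Prop where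
  closed : ∀ u v, G.Adj u v → (u ∈ A ↔ v ∈ A)
  left_mem : a ∈ A
  right_notMem : b ∉ A
  connected : (G.induce A).Connected
  connected_compl : (G.induce Aᶜ).Connected

namespace SimpleGraph

variable {V : Type*} {G : SimpleGraph V} {A : Set V} {a b : V}

theorem Reachable.induce_of_closed (hA : ∀ u v, G.Adj u v → (u ∈ A ↔ v ∈ A)) {x y : V}
    (h : G.Reachable x y) (hx : x ∈ A) :
    ∃ hy : y ∈ A, (G.induce A).Reachable ⟨x, hx⟩ ⟨y, hy⟩ := by
  obtain ⟨p⟩ := h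
  induction p with
  | nil => exact ⟨hx, Reachable.refl _⟩
  | cons hadj p ih =>
    have hv := (hA _ _ hadj).1 hx
    obtain ⟨hy, hr⟩ := ih hv
    refine ⟨hy, Reachable.trans (Adj.reachable ?_) hr⟩
    simpa using hadj

theorem Reachable.of_induce {x y : A} (h : (G.induce A).Reachable x y) :
    G.Reachable (x : V) y :=
  h.map (Embedding.induce A).toHom

theorem Separates.eq_setOf_reachable (h : G.Separates A a b) : A = {x | G.Reachable a x} := by
  ext x
  constructor
  · intro hx
    exact Reachable.of_induce (h.connected.preconnected ⟨a, h.left_mem⟩ ⟨x, hx⟩)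
  · intro hx
    exact (Reachable.induce_of_closed h.closed hx h.left_mem).1

theorem Separates.not_connected (h : G.Separates A a b) : ¬ G.Connected := fun hG =>
  h.right_notMem (Reachable.induce_of_closed h.closed (hG.preconnected a b) h.left_mem).1

theorem Separates.connected_sup_edge (h : G.Separates A a b) : (G ⊔ edge a b).Connected := by
  rw [connected_iff_exists_forall_reachable]
  refine ⟨a, fun x => ?_⟩
  by_cases hx : x ∈ A
  · exact (Reachable.of_induce (h.connected.preconnected ⟨a, h.left_mem⟩ ⟨x, hx⟩)).mono le_sup_left
  · have hab : (G ⊔ edge a b).Adj a b := by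
      have : a ≠ b := fun e => h.right_notMem (e ▸ h.left_mem)
      simp [edge_adj, this]
    exact hab.reachable.trans
      ((Reachable.of_induce (h.connected_compl.preconnected ⟨b, h.right_notMem⟩ ⟨x, hx⟩)).mono
        le_sup_left)

/-- If an edge `ab` reconnects a disconnected graph, then the component of `a` and its complement
are the two components. -/
theorem Connected.separates_of_sup_edge (h : (G ⊔ edge a b).Connected) (hG : ¬ G.Connected) :
    G.Separates {x | G.Reachable a x} a b := by
  have key : ∀ x, G.Reachable a x ∨ G.Reachable b x := by
    intro x
    have hcl : ∀ u v, (G ⊔ edge a b).Adj u v →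
        (u ∈ {x | G.Reachable a x ∨ G.Reachable b x} ↔
          v ∈ {x | G.Reachable a x ∨ G.Reachable b x}) := by
      intro u v huv
      rw [sup_adj, edge_adj] at huv
      rcases huv with huv | ⟨⟨rfl, rfl⟩ | ⟨rfl, rfl⟩, -⟩
      · exact ⟨fun h => h.imp (·.trans huv.reachable) (·.trans huv.reachable),
          fun h => h.imp (·.trans huv.symm.reachable) (·.trans huv.symm.reachable)⟩
      · simp
      · simp
    exact (Reachable.induce_of_closed hcl (h.preconnected a x) (Or.inl (Reachable.refl _))).1
  have hab : ¬ G.Reachable a b := by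
    intro hab
    apply hG
    rw [connected_iff_exists_forall_reachable]
    exact ⟨a, fun x => (key x).elim id hab.trans⟩
  have hcl : ∀ u v, G.Adj u v → (u ∈ {x | G.Reachable a x} ↔ v ∈ {x | G.Reachable a x}) :=
    fun u v huv => ⟨fun h => h.trans huv.reachable, fun h => h.trans huv.symm.reachable⟩
  have hcl' : ∀ u v, G.Adj u v →
      (u ∈ {x | G.Reachable a x}ᶜ ↔ v ∈ {x | G.Reachable a x}ᶜ) :=
    fun u v huv => not_congr (hcl u v huv)
  refine ⟨hcl, Reachable.refl _, hab, ?_, ?_⟩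
  · rw [connected_iff_exists_forall_reachable]
    exact ⟨⟨a, Reachable.refl _⟩, fun x => (Reachable.induce_of_closed hcl x.2 _).2⟩
  · rw [connected_iff_exists_forall_reachable]
    exact ⟨⟨b, hab⟩, fun x =>
      (Reachable.induce_of_closed hcl' ((key x).resolve_left x.2) _).2⟩

end SimpleGraph

/-! ### Sequences of edges -/

/-- The simple graph drawn by a family of ordered pairs of vertices: loops are dropped and
multiplicities and orientations are forgotten. -/
def edgeGraph {E V : Type*} (s : E → V × V) : SimpleGraph V :=
  SimpleGraph.fromEdgeSet (Set.range fun i => s((s i).1, (s i).2))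

theorem edgeGraph_adj {E V : Type*} {s : E → V × V} {u v : V} :
    (edgeGraph s).Adj u v ↔ (∃ i, s i = (u, v) ∨ s i = (v, u)) ∧ u ≠ v := by
  simp only [edgeGraph, SimpleGraph.fromEdgeSet_adj, Set.mem_range, Sym2.eq_iff, Prod.ext_iff]

/-- The number of families of ordered pairs of vertices, indexed by `E`, whose graph is connected
on `V`. -/
noncomputable def connSeqCount (E V : Type*) : ℕ :=
  Nat.card {s : E → V × V // (edgeGraph s).Connected}

theorem connSeqCount_congr {E E' V V' : Type*} (e : E ≃ E') (f : V ≃ V') :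
    connSeqCount E V = connSeqCount E' V' := by
  refine Nat.card_congr (Equiv.subtypeEquiv (Equiv.arrowCongr e (f.prodCongr f)) fun s => ?_)
  refine SimpleGraph.Iso.connected_iff ⟨f, ?_⟩
  intro u v
  simp only [edgeGraph_adj, ne_eq, EmbeddingLike.apply_eq_iff_eq]
  refine and_congr_left fun _ => ?_
  rw [← e.exists_congr_right]
  simp [Prod.ext_iff]

theorem edgeGraph_option {E V : Type*} (s : E → V × V) (p : V × V) :
    edgeGraph (fun o : Option E => o.elim p s) = edgeGraph s ⊔ SimpleGraph.edge p.1 p.2 := by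
  ext u v
  simp only [SimpleGraph.sup_adj, edgeGraph_adj, SimpleGraph.edge_adj, Option.exists,
    Option.elim_none, Option.elim_some, Prod.ext_iff]
  grind

/-- The edges indexed by `M` lie inside `A`, the other edges lie outside `A`, and both parts are
connected graphs. -/
structure EdgeSplit {E V : Type*} (s : E → V × V) (A : Finset V) (M : Finset E) : Prop where
  inside : ∀ i ∈ M, (s i).1 ∈ A ∧ (s i).2 ∈ A
  outside : ∀ i ∉ M, (s i).1 ∉ A ∧ (s i).2 ∉ A
  connected : ((edgeGraph s).induce {x | x ∈ A}).Connected
  connected_compl : ((edgeGraph s).induce {x | x ∉ A}).Connected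

/-- If the edges with index satisfying `q` lie inside the vertex set `p` and the other edges lie
outside it, then the graph induced on `p` is drawn by the edges of the first kind. -/
theorem induce_edgeGraph_eq {E V : Type*} {s : E → V × V} {p : V → Prop} {q : E → Prop}
    (t : {i // q i} → {x // p x} × {x // p x})
    (ht : ∀ i : {i // q i}, s i = ((t i).1.1, (t i).2.1))
    (hs : ∀ i, ¬ q i → ¬ p (s i).1 ∧ ¬ p (s i).2) :
    (edgeGraph s).induce {x | p x} = edgeGraph t := by
  ext ⟨u, hu⟩ ⟨v, hv⟩
  simp only [SimpleGraph.comap_adj, Function.Embedding.subtype_apply, edgeGraph_adj, ne_eq,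
    Subtype.mk.injEq]
  refine and_congr_left fun _ => ⟨?_, ?_⟩
  · rintro ⟨i, hi⟩
    by_cases hq : q i
    · refine ⟨⟨i, hq⟩, ?_⟩
      rw [show s i = _ from ht ⟨i, hq⟩] at hi
      simpa [Prod.ext_iff, Subtype.ext_iff] using hi
    · have := hs i hq
      rcases hi with hi | hi <;> rw [hi] at this
      · exact absurd hu this.1
      · exact absurd hv this.1
  · rintro ⟨i, hi⟩
    refine ⟨i, ?_⟩
    rw [ht i]
    rcases hi with hi | hi <;> simp [hi]

theorem card_edgeSplit {E V : Type*} (A : Finset V) (M : Finset E) :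
    Nat.card {s : E → V × V // EdgeSplit s A M} =
      connSeqCount {i // i ∈ M} {x // x ∈ A} * connSeqCount {i // i ∉ M} {x // x ∉ A} := by
  classical
  rw [connSeqCount, connSeqCount, ← Nat.card_prod]
  have hl : ∀ s : {s : E → V × V // EdgeSplit s A M}, (edgeGraph fun i : {i // i ∈ M} =>
      ((⟨(s.1 i).1, (s.2.inside i i.2).1⟩, ⟨(s.1 i).2, (s.2.inside i i.2).2⟩) :
        {x // x ∈ A} × {x // x ∈ A})).Connected := by
    intro s
    rw [← induce_edgeGraph_eq (s := s.1) (p := (· ∈ A)) (q := (· ∈ M)) _ (fun i => rfl)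
      s.2.outside]
    exact s.2.connected
  have hr : ∀ s : {s : E → V × V // EdgeSplit s A M}, (edgeGraph fun i : {i // i ∉ M} =>
      ((⟨(s.1 i).1, (s.2.outside i i.2).1⟩, ⟨(s.1 i).2, (s.2.outside i i.2).2⟩) :
        {x // x ∉ A} × {x // x ∉ A})).Connected := by
    intro s
    rw [← induce_edgeGraph_eq (s := s.1) (p := (· ∉ A)) (q := (· ∉ M)) _ (fun i => rfl)
      (fun i hi => by simpa using s.2.inside i (by simpa using hi))]
    exact s.2.connected_compl
  have hglue : ∀ t : {t : {i // i ∈ M} → {x // x ∈ A} × {x // x ∈ A} // (edgeGraph t).Connected} ×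
      {t : {i // i ∉ M} → {x // x ∉ A} × {x // x ∉ A} // (edgeGraph t).Connected},
      EdgeSplit (fun i => if h : i ∈ M then ((t.1.1 ⟨i, h⟩).1.1, (t.1.1 ⟨i, h⟩).2.1)
        else ((t.2.1 ⟨i, h⟩).1.1, (t.2.1 ⟨i, h⟩).2.1)) A M := by
    intro t
    have h1 : ∀ i ∈ M, ((if h : i ∈ M then ((t.1.1 ⟨i, h⟩).1.1, (t.1.1 ⟨i, h⟩).2.1)
        else ((t.2.1 ⟨i, h⟩).1.1, (t.2.1 ⟨i, h⟩).2.1)) : V × V).1 ∈ A ∧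
        ((if h : i ∈ M then ((t.1.1 ⟨i, h⟩).1.1, (t.1.1 ⟨i, h⟩).2.1)
        else ((t.2.1 ⟨i, h⟩).1.1, (t.2.1 ⟨i, h⟩).2.1)) : V × V).2 ∈ A := by
      intro i hi
      rw [dif_pos hi]
      exact ⟨(t.1.1 ⟨i, hi⟩).1.2, (t.1.1 ⟨i, hi⟩).2.2⟩
    have h2 : ∀ i ∉ M, ((if h : i ∈ M then ((t.1.1 ⟨i, h⟩).1.1, (t.1.1 ⟨i, h⟩).2.1)
        else ((t.2.1 ⟨i, h⟩).1.1, (t.2.1 ⟨i, h⟩).2.1)) : V × V).1 ∉ A ∧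
        ((if h : i ∈ M then ((t.1.1 ⟨i, h⟩).1.1, (t.1.1 ⟨i, h⟩).2.1)
        else ((t.2.1 ⟨i, h⟩).1.1, (t.2.1 ⟨i, h⟩).2.1)) : V × V).2 ∉ A := by
      intro i hi
      rw [dif_neg hi]
      exact ⟨(t.2.1 ⟨i, hi⟩).1.2, (t.2.1 ⟨i, hi⟩).2.2⟩
    refine ⟨h1, h2, ?_, ?_⟩
    · rw [induce_edgeGraph_eq (p := (· ∈ A)) (q := (· ∈ M)) t.1.1
        (fun i => by rw [dif_pos i.2]) h2]
      exact t.1.2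
    · rw [induce_edgeGraph_eq (p := (· ∉ A)) (q := (· ∉ M)) t.2.1
        (fun i => by rw [dif_neg i.2]) (fun i hi => by simpa using h1 i (by simpa using hi))]
      exact t.2.2
  refine Nat.card_congr ⟨fun s => (⟨_, hl s⟩, ⟨_, hr s⟩), fun t => ⟨_, hglue t⟩, ?_, ?_⟩
  · intro s
    ext i <;> by_cases h : i ∈ M <;> simp [h]
  · rintro ⟨t, t'⟩
    ext i
    · simp
    · simp
    · simp [i.2]
    · simp [i.2]

theorem EdgeSplit.separates {E V : Type*} {s : E → V × V} {A : Finset V} {M : Finset E}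
    (h : EdgeSplit s A M) {a b : V} (ha : a ∈ A) (hb : b ∉ A) :
    (edgeGraph s).Separates {x | x ∈ A} a b := by
  refine ⟨?_, ha, hb, h.connected, h.connected_compl⟩
  intro u v huv
  obtain ⟨⟨i, hi⟩, -⟩ := edgeGraph_adj.1 huv
  have h1 := h.inside i
  have h2 := h.outside i
  by_cases hM : i ∈ M <;> rcases hi with hi | hi <;> simp_all

theorem SimpleGraph.Separates.edgeSplit {E V : Type*} [Fintype E] [DecidableEq V] {s : E → V × V}
    {A : Finset V} {a b : V} (h : (edgeGraph s).Separates {x | x ∈ A} a b) :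
    EdgeSplit s A {i | (s i).1 ∈ A} := by
  have key : ∀ i, (s i).1 ∈ A ↔ (s i).2 ∈ A := by
    intro i
    by_cases hi : (s i).1 = (s i).2
    · rw [hi]
    · exact h.closed _ _ (edgeGraph_adj.2 ⟨⟨i, Or.inl rfl⟩, hi⟩)
  refine ⟨?_, ?_, h.connected, h.connected_compl⟩
  · intro i hi
    have : (s i).1 ∈ A := by simpa using hi
    exact ⟨this, (key i).1 this⟩
  · intro i hi
    have : (s i).1 ∉ A := by simpa using hi
    exact ⟨this, fun h => this ((key i).2 h)⟩

theorem EdgeSplit.eq_filter {E V : Type*} [Fintype E] [DecidableEq V] {s : E → V × V}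
    {A : Finset V} {M : Finset E} (h : EdgeSplit s A M) : M = ({i | (s i).1 ∈ A} : Finset E) := by
  ext i
  by_cases hM : i ∈ M
  · simp [hM, (h.inside i hM).1]
  · simp [hM, (h.outside i hM).1]

open Classical in
/-- Deleting the edge `p` from a connected graph leaves either a connected graph or two components,
one for each end of `p`. -/
theorem indicator_connected_option {E V : Type*} [Fintype E] [Fintype V] (s : E → V × V)
    (p : V × V) :
    (if (edgeGraph fun o : Option E => o.elim p s).Connected then 1 else 0 : ℕ) =
      (if (edgeGraph s).Connected then 1 else 0) +
        ∑ q : Finset V × Finset E,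
          if p.1 ∈ q.1 ∧ p.2 ∉ q.1 ∧ EdgeSplit s q.1 q.2 then 1 else 0 := by
  rw [edgeGraph_option]
  by_cases hs : (edgeGraph s).Connected
  · rw [if_pos hs, if_pos (hs.mono le_sup_left), Finset.sum_eq_zero, add_zero]
    rintro ⟨A, M⟩ -
    rw [if_neg]
    rintro ⟨ha, hb, h⟩
    exact (h.separates ha hb).not_connected hs
  rw [if_neg hs, zero_add]
  by_cases hp : (edgeGraph s ⊔ SimpleGraph.edge p.1 p.2).Connected
  · have hsep := hp.separates_of_sup_edge hs
    set A : Finset V := {x | (edgeGraph s).Reachable p.1 x} with hA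
    have hA' : {x | x ∈ A} = {x | (edgeGraph s).Reachable p.1 x} := by ext; simp [hA]
    rw [← hA'] at hsep
    rw [if_pos hp, Finset.sum_eq_single (A, ({i | (s i).1 ∈ A} : Finset E)), if_pos]
    · exact ⟨hsep.left_mem, hsep.right_notMem, hsep.edgeSplit⟩
    · rintro ⟨B, M⟩ - hne
      rw [if_neg]
      rintro ⟨ha, hb, h⟩
      apply hne
      have hB : B = A := by
        have := (h.separates ha hb).eq_setOf_reachable.trans hA'.symm
        ext x
        exact Set.ext_iff.1 this x
      have hM := h.eq_filter
      simp only at hM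
      rw [hM]
      simp only [hB]
    · simp
  · rw [if_neg hp, Finset.sum_eq_zero]
    rintro ⟨A, M⟩ -
    rw [if_neg]
    rintro ⟨ha, hb, h⟩
    exact hp (h.separates ha hb).connected_sup_edge

theorem natCard_subtype_eq_sum {α : Type*} [Fintype α] (p : α → Prop) [DecidablePred p] :
    Nat.card {a // p a} = ∑ a, if p a then 1 else 0 := by
  rw [Nat.card_eq_fintype_card, Fintype.card_subtype, Finset.card_filter]

theorem connSeqCount_option {E V : Type*} [Fintype E] [Fintype V] [DecidableEq V] :
    connSeqCount (Option E) V = Fintype.card V ^ 2 * connSeqCount E V +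
      ∑ A : Finset V, ∑ M : Finset E, A.card * (Fintype.card V - A.card) *
        (connSeqCount {i // i ∈ M} {x // x ∈ A} * connSeqCount {i // i ∉ M} {x // x ∉ A}) := by
  classical
  have e : {t : (V × V) × (E → V × V) //
      (edgeGraph fun o : Option E => o.elim t.1 t.2).Connected} ≃
      {s : Option E → V × V // (edgeGraph s).Connected} := by
    refine Equiv.subtypeEquiv ⟨fun t o => o.elim t.1 t.2, fun s => (s none, fun i => s (some i)),
      fun t => rfl, fun s => ?_⟩ fun t => Iff.rfl
    funext o
    cases o <;> rfl
  rw [connSeqCount, ← Nat.card_congr e, natCard_subtype_eq_sum, Fintype.sum_prod_type]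
  trans ∑ p : V × V, ((∑ s : E → V × V, if (edgeGraph s).Connected then 1 else 0) +
      ∑ s : E → V × V, ∑ q : Finset V × Finset E,
        if p.1 ∈ q.1 ∧ p.2 ∉ q.1 ∧ EdgeSplit s q.1 q.2 then 1 else 0)
  · refine Finset.sum_congr rfl fun p _ => ?_
    rw [← Finset.sum_add_distrib]
    refine Finset.sum_congr rfl fun s _ => ?_
    convert indicator_connected_option s p
  rw [Finset.sum_add_distrib]
  congr 1
  · rw [← natCard_subtype_eq_sum]
    simp [connSeqCount, sq]
  · rw [Finset.sum_congr rfl fun p _ => Finset.sum_comm, Finset.sum_comm]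
    conv_rhs => rw [← Fintype.sum_prod_type']
    refine Finset.sum_congr rfl fun q _ => ?_
    rw [← card_edgeSplit, natCard_subtype_eq_sum, Fintype.sum_prod_type]
    simp_rw [← and_assoc, ite_and (_ ∧ _)]
    have : ∀ a b : V, (∑ s : E → V × V, if a ∈ q.1 ∧ b ∉ q.1 then
        (if EdgeSplit s q.1 q.2 then 1 else 0) else 0) =
        (if a ∈ q.1 then 1 else 0) * ((if b ∉ q.1 then 1 else 0) *
          ∑ s : E → V × V, if EdgeSplit s q.1 q.2 then 1 else 0) := by
      intro a b
      by_cases ha : a ∈ q.1 <;> by_cases hb : b ∈ q.1 <;> simp [ha, hb]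
    simp_rw [this]
    simp_rw [← Finset.mul_sum, ← Finset.sum_mul]
    have h2 : (∑ b : V, if b ∉ q.1 then 1 else 0) = Fintype.card V - q.1.card := by
      rw [← Finset.card_filter, ← Finset.card_compl]
      congr 1
      ext; simp
    rw [h2]
    simp [mul_assoc]

/-! ### The recurrence for connected multigraphs -/

theorem Multigraph.isConnected_ofSeq {n m : ℕ} (s : Fin m → Fin n × Fin n) :
    (Multigraph.ofSeq s).IsConnected ↔ (edgeGraph s).Connected := by
  rw [Multigraph.IsConnected, edgeGraph]
  have : {e : Sym2 (Fin n) | e ∈ Multigraph.ofSeq s} = Set.range fun i => s((s i).1, (s i).2) := by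
    ext e
    simp [Multigraph.ofSeq]
  rw [this]

theorem connectedMultigraphNumber_eq (m n : ℕ) :
    connectedMultigraphNumber m n =
      (connSeqCount (Fin m) (Fin n) : ℝ) / (2 ^ m * (m.factorial : ℝ)) := by
  classical
  simp only [connectedMultigraphNumber, Multigraph.kappa]
  rw [← Finset.sum_div, ← Nat.cast_sum]
  congr 2
  rw [connSeqCount, natCard_subtype_eq_sum, ← Finset.card_filter,
    Finset.card_eq_sum_card_fiberwise (f := Multigraph.ofSeq)
      (t := Finset.univ.filter fun G : Multigraph n m => G.IsConnected)]
  · refine Finset.sum_congr rfl fun G hG => ?_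
    rw [Multigraph.seqv, Fintype.card_subtype]
    congr 1
    ext s
    simp only [Finset.mem_filter, Finset.mem_univ, true_and] at hG ⊢
    rw [← Multigraph.isConnected_ofSeq]
    constructor
    · rintro rfl
      exact ⟨hG, rfl⟩
    · exact fun h => h.2
  · intro s hs
    simpa [Multigraph.isConnected_ofSeq] using hs

theorem connSeqCount_fin_succ (m n : ℕ) :
    connSeqCount (Fin (m + 1)) (Fin n) = n ^ 2 * connSeqCount (Fin m) (Fin n) +
      ∑ k ∈ Finset.range (n + 1), n.choose k * ∑ j ∈ Finset.range (m + 1), m.choose j *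
        (k * (n - k) * (connSeqCount (Fin j) (Fin k) *
          connSeqCount (Fin (m - j)) (Fin (n - k)))) := by
  rw [connSeqCount_congr (finSuccEquiv m) (Equiv.refl (Fin n)), connSeqCount_option,
    Fintype.card_fin]
  congr 1
  have h1 : ∀ A : Finset (Fin n), ∀ M : Finset (Fin m), A.card * (n - A.card) *
      (connSeqCount {i // i ∈ M} {x // x ∈ A} * connSeqCount {i // i ∉ M} {x // x ∉ A}) =
      A.card * (n - A.card) * (connSeqCount (Fin M.card) (Fin A.card) *
        connSeqCount (Fin (m - M.card)) (Fin (n - A.card))) := by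
    intro A M
    have e1 : {i // i ∈ M} ≃ Fin M.card := Fintype.equivFinOfCardEq (by simp)
    have e2 : {i // i ∈ A} ≃ Fin A.card := Fintype.equivFinOfCardEq (by simp)
    have e3 : {i // i ∉ M} ≃ Fin (m - M.card) := Fintype.equivFinOfCardEq (by
      rw [Fintype.card_subtype_compl]; simp)
    have e4 : {i // i ∉ A} ≃ Fin (n - A.card) := Fintype.equivFinOfCardEq (by
      rw [Fintype.card_subtype_compl]; simp)
    rw [connSeqCount_congr e1 e2, connSeqCount_congr e3 e4]
  simp_rw [h1]
  have h2 := fun f : ℕ → ℕ => Finset.sum_powerset_apply_card f (x := (Finset.univ : Finset (Fin n)))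
  have h3 := fun f : ℕ → ℕ => Finset.sum_powerset_apply_card f (x := (Finset.univ : Finset (Fin m)))
  simp only [Finset.powerset_univ, Finset.card_fin, smul_eq_mul] at h2 h3
  rw [Finset.sum_congr rfl fun A _ => h3 fun j => A.card * (n - A.card) *
      (connSeqCount (Fin j) (Fin A.card) * connSeqCount (Fin (m - j)) (Fin (n - A.card)))]
  rw [h2 fun k => ∑ j ∈ Finset.range (m + 1), m.choose j *
        (k * (n - k) * (connSeqCount (Fin j) (Fin k) *
          connSeqCount (Fin (m - j)) (Fin (n - k))))]

/-- The recurrence obtained by marking one edge of a connected multigraph and deleting it. -/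
theorem connectedMultigraphNumber_succ (m n : ℕ) :
    (m + 1 : ℝ) * connectedMultigraphNumber (m + 1) n =
      1 / 2 * ((n : ℝ) ^ 2 * connectedMultigraphNumber m n +
        ∑ p ∈ Finset.HasAntidiagonal.antidiagonal n, (n.choose p.1 : ℝ) * (p.1 * p.2 *
          ∑ q ∈ Finset.HasAntidiagonal.antidiagonal m,
            connectedMultigraphNumber q.1 p.1 * connectedMultigraphNumber q.2 p.2)) := by
  simp only [connectedMultigraphNumber_eq]
  rw [connSeqCount_fin_succ]
  have hL : (m + 1 : ℝ) * (((n ^ 2 * connSeqCount (Fin m) (Fin n) +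
      ∑ k ∈ Finset.range (n + 1), n.choose k * ∑ j ∈ Finset.range (m + 1), m.choose j *
        (k * (n - k) * (connSeqCount (Fin j) (Fin k) *
          connSeqCount (Fin (m - j)) (Fin (n - k)))) : ℕ) : ℝ) /
            (2 ^ (m + 1) * ((m + 1).factorial : ℝ))) =
      1 / 2 * ((n ^ 2 * connSeqCount (Fin m) (Fin n) +
      ∑ k ∈ Finset.range (n + 1), n.choose k * ∑ j ∈ Finset.range (m + 1), m.choose j *
        (k * (n - k) * (connSeqCount (Fin j) (Fin k) *
          connSeqCount (Fin (m - j)) (Fin (n - k)))) : ℕ) / (2 ^ m * (m.factorial : ℝ))) := by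
    rw [Nat.factorial_succ]
    have := Nat.factorial_pos m
    push_cast
    field_simp
    ring
  rw [hL]
  congr 1
  push_cast
  rw [add_div, mul_div_assoc]
  congr 1
  rw [Finset.sum_div, Finset.Nat.sum_antidiagonal_eq_sum_range_succ_mk]
  refine Finset.sum_congr rfl fun k hk => ?_
  rw [mul_div_assoc]
  congr 1
  rw [Finset.sum_div, Finset.mul_sum, Finset.Nat.sum_antidiagonal_eq_sum_range_succ_mk]
  refine Finset.sum_congr rfl fun j hj => ?_
  have hj' : j ≤ m := by simpa [Nat.lt_succ_iff] using hj
  have hk' : k ≤ n := by simpa [Nat.lt_succ_iff] using hk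
  have hp : (2 : ℝ) ^ m = 2 ^ j * 2 ^ (m - j) := by rw [← pow_add]; congr 1; omega
  have hf : (m.choose j : ℝ) * (j.factorial * (m - j).factorial) = m.factorial := by
    rw [← mul_assoc]; exact_mod_cast Nat.choose_mul_factorial_mul_factorial hj'
  have h1 := Nat.factorial_pos m
  have h2 := Nat.factorial_pos j
  have h3 := Nat.factorial_pos (m - j)
  have h4 : (m.choose j : ℝ) ≠ 0 := by exact_mod_cast (Nat.choose_pos hj').ne'
  rw [hp, ← hf]
  field_simp

theorem connectedMultigraphNumber_nonneg (m n : ℕ) : 0 ≤ connectedMultigraphNumber m n := by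
  rw [connectedMultigraphNumber_eq]; positivity

theorem connectedMultigraphNumber_zero_right (m : ℕ) : connectedMultigraphNumber m 0 = 0 := by
  rw [connectedMultigraphNumber_eq, connSeqCount]
  have : IsEmpty {s : Fin m → Fin 0 × Fin 0 // (edgeGraph s).Connected} :=
    ⟨fun s => s.2.nonempty.elim fun x => x.elim0⟩
  simp

theorem connectedMultigraphNumber_zero_one : connectedMultigraphNumber 0 1 = 1 := by
  rw [connectedMultigraphNumber_eq, connSeqCount]
  have : Unique {s : Fin 0 → Fin 1 × Fin 1 // (edgeGraph s).Connected} :=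
    { default := ⟨Fin.elim0, SimpleGraph.Connected.of_subsingleton⟩
      uniq := fun s => Subsingleton.elim _ _ }
  simp

/-- A connected multigraph has at least as many edges as vertices, minus one. -/
theorem connectedMultigraphNumber_eq_zero {m n : ℕ} (h : m + 1 < n) :
    connectedMultigraphNumber m n = 0 := by
  rw [connectedMultigraphNumber_eq, connSeqCount]
  have : IsEmpty {s : Fin m → Fin n × Fin n // (edgeGraph s).Connected} := by
    refine ⟨fun s => ?_⟩
    have h1 := s.2.card_vert_le_card_edgeSet_add_one
    have h2 : Nat.card (edgeGraph s.1).edgeSet ≤ m := by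
      have hsub : (edgeGraph s.1).edgeSet ⊆ Set.range fun i => s((s.1 i).1, (s.1 i).2) := by
        rw [edgeGraph, SimpleGraph.edgeSet_fromEdgeSet]
        exact Set.sdiff_subset
      have h3 := Set.ncard_le_ncard hsub (Set.finite_range _)
      have h4 : (Set.range fun i => s((s.1 i).1, (s.1 i).2)).ncard ≤ m := by
        rw [← Set.image_univ]
        refine (Set.ncard_image_le (Set.toFinite _)).trans ?_
        simp
      exact h3.trans h4
    rw [Nat.card_eq_fintype_card, Fintype.card_fin] at h1
    omega
  simp

open Finset.HasAntidiagonal (antidiagonal)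
open PowerSeries (coeff)

/-! ### The Euler operator on power series -/

/-- The Euler operator `X * d/dX` on real power series, which multiplies the `n`-th coefficient
by `n`. -/
noncomputable def eulerOp : Derivation ℝ (PowerSeries ℝ) (PowerSeries ℝ) :=
  (PowerSeries.X : PowerSeries ℝ) • PowerSeries.derivative ℝ

theorem coeff_eulerOp (n : ℕ) (f : PowerSeries ℝ) : coeff n (eulerOp f) = n * coeff n f := by
  cases n <;> simp [eulerOp, PowerSeries.coeff_succ_X_mul, PowerSeries.coeff_derivative, mul_comm]

theorem eulerOp_mul (f g : PowerSeries ℝ) : eulerOp (f * g) = f * eulerOp g + g * eulerOp f :=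
  eulerOp.leibniz f g

theorem eulerOp_pow (f : PowerSeries ℝ) (k : ℕ) :
    eulerOp (f ^ (k + 1)) = (k + 1 : ℝ) • (f ^ k * eulerOp f) := by
  rw [eulerOp.leibniz_pow, Nat.add_sub_cancel, ← Nat.cast_smul_eq_nsmul ℝ]
  simp

/-! ### Generating functions of connected multigraphs by excess -/

/-- The exponential generating function, according to the number of vertices `n`, of the connected
multigraphs with `n + s - 1` edges. The truncated subtraction only matters for `n = s = 0`, where
the coefficient vanishes. -/
noncomputable def excessSeries (s : ℕ) : PowerSeries ℝ :=
  PowerSeries.mk fun n => connectedMultigraphNumber (n + s - 1) n / (n.factorial : ℝ)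

theorem coeff_excessSeries (s n : ℕ) :
    coeff n (excessSeries s) = connectedMultigraphNumber (n + s - 1) n / (n.factorial : ℝ) :=
  PowerSeries.coeff_mk _ _

theorem coeff_zero_excessSeries (s : ℕ) : coeff 0 (excessSeries s) = 0 := by
  rw [coeff_excessSeries, connectedMultigraphNumber_zero_right, zero_div]

/-- In the convolution over the numbers of edges, only pairs that allow both parts to be connected
contribute. -/
theorem sum_antidiagonal_connectedMultigraphNumber {k l s m : ℕ} (hk : 1 ≤ k) (hl : 1 ≤ l)
    (hm : m + 2 = k + l + s) :
    ∑ q ∈ antidiagonal m, connectedMultigraphNumber q.1 k * connectedMultigraphNumber q.2 l =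
      ∑ p ∈ antidiagonal s, connectedMultigraphNumber (k + p.1 - 1) k *
        connectedMultigraphNumber (l + p.2 - 1) l := by
  symm
  refine Finset.sum_of_injOn (fun p => (k + p.1 - 1, l + p.2 - 1)) ?_ ?_ ?_ ?_
  · rintro ⟨a, b⟩ - ⟨a', b'⟩ - h
    simp only [Prod.mk.injEq] at h ⊢
    omega
  · rintro ⟨a, b⟩ h
    simp only [Finset.mem_coe, Finset.HasAntidiagonal.mem_antidiagonal] at h ⊢
    omega
  · rintro ⟨a, b⟩ h hn
    simp only [Finset.HasAntidiagonal.mem_antidiagonal] at h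
    by_cases h1 : a + 1 < k
    · simp [connectedMultigraphNumber_eq_zero h1]
    by_cases h2 : b + 1 < l
    · simp [connectedMultigraphNumber_eq_zero h2]
    refine absurd ⟨(a + 1 - k, b + 1 - l), ?_, ?_⟩ hn
    · simp only [Finset.mem_coe, Finset.HasAntidiagonal.mem_antidiagonal]
      omega
    · simp only [Prod.mk.injEq]
      omega
  · intros
    rfl

theorem coeff_sum_eulerOp_excessSeries {n s m : ℕ} (hm : m + 2 = n + s) :
    (n.factorial : ℝ) * coeff n (∑ a ∈ antidiagonal s,
        eulerOp (excessSeries a.1) * eulerOp (excessSeries a.2)) =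
      ∑ p ∈ antidiagonal n, (n.choose p.1 : ℝ) * (p.1 * p.2 * ∑ q ∈ antidiagonal m,
        connectedMultigraphNumber q.1 p.1 * connectedMultigraphNumber q.2 p.2) := by
  simp only [map_sum, PowerSeries.coeff_mul]
  rw [Finset.sum_comm, Finset.mul_sum]
  refine Finset.sum_congr rfl ?_
  rintro ⟨k, l⟩ hkl
  simp only [Finset.HasAntidiagonal.mem_antidiagonal] at hkl
  subst hkl
  simp only [coeff_eulerOp, coeff_excessSeries]
  rcases Nat.eq_zero_or_pos k with rfl | hk
  · simp
  rcases Nat.eq_zero_or_pos l with rfl | hl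
  · simp
  rw [sum_antidiagonal_connectedMultigraphNumber hk hl hm, Finset.mul_sum, Finset.mul_sum,
    Finset.mul_sum]
  refine Finset.sum_congr rfl fun a _ => ?_
  have hf : ((k + l).choose k : ℝ) * (k.factorial * l.factorial) = (k + l).factorial := by
    rw [← mul_assoc]
    have := Nat.choose_mul_factorial_mul_factorial (Nat.le_add_right k l)
    rw [Nat.add_sub_cancel_left] at this
    exact_mod_cast this
  have h2 := Nat.factorial_pos k
  have h3 := Nat.factorial_pos l
  rw [← hf]
  field_simp

theorem connectedMultigraphNumber_succ_eq_coeff {n s m : ℕ} (hm : m + 2 = n + s) :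
    (m + 1 : ℝ) * connectedMultigraphNumber (m + 1) n =
      1 / 2 * ((n : ℝ) ^ 2 * connectedMultigraphNumber m n + (n.factorial : ℝ) *
        coeff n (∑ a ∈ antidiagonal s,
          eulerOp (excessSeries a.1) * eulerOp (excessSeries a.2))) := by
  rw [coeff_sum_eulerOp_excessSeries hm, connectedMultigraphNumber_succ]

/-- The recurrence for trees. -/
theorem eulerOp_excessSeries_zero :
    eulerOp (excessSeries 0) - excessSeries 0 = (1 / 2 : ℝ) • eulerOp (excessSeries 0) ^ 2 := by
  ext n
  have hF := Nat.factorial_pos n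
  rw [map_sub, coeff_eulerOp, PowerSeries.coeff_smul, smul_eq_mul, sq]
  match n, hF with
  | 0, _ => simp [PowerSeries.coeff_mul, coeff_zero_excessSeries, coeff_eulerOp]
  | 1, _ => simp [PowerSeries.coeff_mul, coeff_eulerOp, Finset.Nat.antidiagonal_succ]
  | n + 2, hF =>
    have h := connectedMultigraphNumber_succ_eq_coeff (n := n + 2) (s := 0) (m := n) rfl
    rw [connectedMultigraphNumber_eq_zero (m := n) (n := n + 2) (by omega)] at h
    rw [coeff_excessSeries]
    simp only [Finset.Nat.antidiagonal_zero, Finset.sum_singleton] at h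
    have h2 : (n + 2 : ℕ) + 0 - 1 = n + 1 := rfl
    rw [h2]
    push_cast at h ⊢
    field_simp
    linear_combination 2 * h

/-- The recurrence for connected multigraphs that are not trees. -/
theorem eulerOp_excessSeries_succ (s : ℕ) :
    eulerOp (excessSeries (s + 1)) + (s : ℝ) • excessSeries (s + 1) =
      (1 / 2 : ℝ) • (eulerOp (eulerOp (excessSeries s)) + ∑ a ∈ antidiagonal (s + 1),
        eulerOp (excessSeries a.1) * eulerOp (excessSeries a.2)) := by
  ext n
  have hF := Nat.factorial_pos n
  rw [map_add, PowerSeries.coeff_smul, PowerSeries.coeff_smul, map_add]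
  simp only [coeff_eulerOp, smul_eq_mul]
  match n, hF with
  | 0, _ => simp [PowerSeries.coeff_mul, coeff_zero_excessSeries, coeff_eulerOp,
      map_sum]
  | n + 1, hF =>
    have h := connectedMultigraphNumber_succ_eq_coeff (n := n + 1) (s := s + 1) (m := n + s)
      (by omega)
    rw [coeff_excessSeries, coeff_excessSeries]
    have h2 : (n + 1 : ℕ) + (s + 1) - 1 = n + s + 1 := by omega
    have h3 : (n + 1 : ℕ) + s - 1 = n + s := by omega
    rw [h2, h3]
    push_cast at h ⊢
    field_simp
    linear_combination 2 * h

/-! ### The tree function -/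

/-- The exponential generating function `T` of rooted trees. -/
noncomputable def rootedTreeSeries : PowerSeries ℝ := eulerOp (excessSeries 0)

/-- The series `1 / (1 - T)`, where `T` is the generating function of rooted trees. -/
noncomputable def pathSeries : PowerSeries ℝ := (1 - rootedTreeSeries)⁻¹

theorem coeff_zero_rootedTreeSeries : coeff 0 rootedTreeSeries = 0 := by
  simp [rootedTreeSeries, coeff_eulerOp]

theorem coeff_one_rootedTreeSeries : coeff 1 rootedTreeSeries = 1 := by
  simp [rootedTreeSeries, coeff_eulerOp, coeff_excessSeries, connectedMultigraphNumber_zero_one]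

theorem constantCoeff_rootedTreeSeries : PowerSeries.constantCoeff rootedTreeSeries = 0 := by
  rw [← PowerSeries.coeff_zero_eq_constantCoeff_apply, coeff_zero_rootedTreeSeries]

theorem pathSeries_mul : pathSeries * (1 - rootedTreeSeries) = 1 :=
  PowerSeries.inv_mul_cancel _ (by simp [constantCoeff_rootedTreeSeries])

theorem rootedTreeSeries_mul_pathSeries : rootedTreeSeries * pathSeries = pathSeries - 1 := by
  linear_combination -pathSeries_mul

theorem eulerOp_rootedTreeSeries_mul :
    eulerOp rootedTreeSeries * (1 - rootedTreeSeries) = rootedTreeSeries := by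
  have h := congrArg eulerOp eulerOp_excessSeries_zero
  rw [map_sub, Derivation.map_smul, eulerOp_pow _ 1, smul_smul] at h
  change eulerOp rootedTreeSeries - rootedTreeSeries =
    _ • (rootedTreeSeries ^ 1 * eulerOp rootedTreeSeries) at h
  norm_num at h
  linear_combination h

theorem eulerOp_rootedTreeSeries :
    eulerOp rootedTreeSeries = rootedTreeSeries * pathSeries := by
  linear_combination pathSeries * eulerOp_rootedTreeSeries_mul -
    eulerOp rootedTreeSeries * pathSeries_mul

theorem eulerOp_pathSeries : eulerOp pathSeries = pathSeries ^ 3 - pathSeries ^ 2 := by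
  have h := congrArg eulerOp pathSeries_mul
  rw [eulerOp_mul, map_sub, Derivation.map_one_eq_zero, zero_sub, eulerOp_rootedTreeSeries,
    rootedTreeSeries_mul_pathSeries] at h
  linear_combination pathSeries * h - eulerOp pathSeries * pathSeries_mul

theorem eulerOp_rootedTreeSeries_pow (k : ℕ) :
    eulerOp (rootedTreeSeries ^ k) = (k : ℝ) • (rootedTreeSeries ^ k * pathSeries) := by
  cases k with
  | zero => simp
  | succ k =>
    rw [eulerOp_pow, eulerOp_rootedTreeSeries, ← mul_assoc, ← pow_succ]
    simp

theorem coeff_rootedTreeSeries_pow_self (k : ℕ) : coeff k (rootedTreeSeries ^ k) = 1 := by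
  obtain ⟨U, hU⟩ := PowerSeries.X_dvd_iff.2 constantCoeff_rootedTreeSeries
  have h1 := coeff_one_rootedTreeSeries
  rw [hU, PowerSeries.coeff_succ_X_mul, PowerSeries.coeff_zero_eq_constantCoeff_apply] at h1
  rw [hU, mul_pow]
  have := PowerSeries.coeff_X_pow_mul (U ^ k) k 0
  rw [zero_add] at this
  simp [this, h1]

theorem coeff_rootedTreeSeries_pow_of_lt {n k : ℕ} (h : n < k) (f : PowerSeries ℝ) :
    coeff n (rootedTreeSeries ^ k * f) = 0 := by
  obtain ⟨U, hU⟩ := PowerSeries.X_dvd_iff.2 constantCoeff_rootedTreeSeries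
  rw [hU, mul_pow, mul_assoc, PowerSeries.coeff_X_pow_mul', if_neg (by omega)]

/-- The coefficients of the powers of the tree function. The differential equation of `T` relates
the coefficients of `T ^ k` and `T ^ (k + 1)` in the same degree, which gives a descent to the
leading coefficient. -/
theorem coeff_rootedTreeSeries_pow (d k : ℕ) (hk : 1 ≤ k) :
    ((k + d : ℕ) : ℝ) * coeff (k + d) (rootedTreeSeries ^ k) =
      k * ((k + d : ℕ) : ℝ) ^ d / d.factorial := by
  induction d generalizing k with
  | zero => simp [coeff_rootedTreeSeries_pow_self]
  | succ d ih =>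
    have h1 : (k + 1 : ℝ) • eulerOp (rootedTreeSeries ^ k) -
        (k : ℝ) • eulerOp (rootedTreeSeries ^ (k + 1)) =
          (k * (k + 1) : ℝ) • rootedTreeSeries ^ k := by
      rw [eulerOp_rootedTreeSeries_pow, eulerOp_rootedTreeSeries_pow, smul_smul, smul_smul,
        Nat.cast_succ, mul_comm (k + 1 : ℝ), ← smul_sub, pow_succ]
      congr 1
      linear_combination rootedTreeSeries ^ k * pathSeries_mul
    have h2 := congrArg (coeff (k + (d + 1))) h1
    simp only [map_sub, PowerSeries.coeff_smul, coeff_eulerOp, smul_eq_mul] at h2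
    have h3 := ih (k + 1) (by omega)
    rw [show k + 1 + d = k + (d + 1) by ring] at h3
    rw [h3] at h2
    have hk' : (0 : ℝ) < k := by exact_mod_cast hk
    have h4 : (k + 1 : ℝ) * (d + 1) * coeff (k + (d + 1)) (rootedTreeSeries ^ k) =
        k * ((k + 1) * ((k + (d + 1) : ℕ) : ℝ) ^ d / d.factorial) := by
      push_cast at h2 ⊢
      linear_combination h2
    rw [Nat.factorial_succ, pow_succ]
    have hF := Nat.factorial_pos d
    push_cast at h4 ⊢
    field_simp at h4 ⊢
    linear_combination h4

theorem coeff_rootedTreeSeries_pow_mul_pathSeries {n k : ℕ} (hk : 1 ≤ k) (hkn : k ≤ n) :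
    coeff n (rootedTreeSeries ^ k * pathSeries) = (n : ℝ) ^ (n - k) / (n - k).factorial := by
  obtain ⟨d, rfl⟩ := Nat.exists_eq_add_of_le hkn
  have h := congrArg (coeff (k + d)) (eulerOp_rootedTreeSeries_pow k)
  rw [coeff_eulerOp, coeff_rootedTreeSeries_pow d k hk, PowerSeries.coeff_smul, smul_eq_mul,
    mul_div_assoc] at h
  have hk' : (k : ℝ) ≠ 0 := by positivity
  rw [Nat.add_sub_cancel_left]
  exact (mul_left_cancel₀ hk' h).symm

theorem coeff_zero_pathSeries : coeff 0 pathSeries = 1 := by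
  have h := congrArg (coeff 0) rootedTreeSeries_mul_pathSeries
  rw [map_sub] at h
  simp [constantCoeff_rootedTreeSeries] at h
  simp only [PowerSeries.coeff_zero_eq_constantCoeff]
  linarith

theorem coeff_pathSeries (n : ℕ) : coeff n pathSeries = (n : ℝ) ^ n / n.factorial := by
  rcases Nat.eq_zero_or_pos n with rfl | hn
  · simpa using coeff_zero_pathSeries
  have h := congrArg (coeff n) rootedTreeSeries_mul_pathSeries
  have h1 := coeff_rootedTreeSeries_pow_mul_pathSeries (n := n) le_rfl hn
  rw [pow_one, h, map_sub, PowerSeries.coeff_one, if_neg hn.ne', sub_zero] at h1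
  obtain ⟨m, rfl⟩ := Nat.exists_eq_add_of_le' hn
  rw [h1, Nat.add_sub_cancel, Nat.factorial_succ, pow_succ]
  have hF := Nat.factorial_pos m
  push_cast
  field_simp

/-- Expanding `1 / (1 - T) ^ 2` as the sum of the `T ^ k / (1 - T)` gives a truncated exponential
sum. -/
theorem coeff_pathSeries_sq (n : ℕ) :
    coeff n (pathSeries ^ 2) = ∑ j ∈ Finset.range (n + 1), (n : ℝ) ^ j / j.factorial := by
  have h1 : ∀ N, pathSeries ^ 2 = ∑ k ∈ Finset.range N, rootedTreeSeries ^ k * pathSeries +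
      rootedTreeSeries ^ N * pathSeries ^ 2 := by
    intro N
    induction N with
    | zero => simp
    | succ N ih =>
      rw [Finset.sum_range_succ, pow_succ]
      linear_combination ih - rootedTreeSeries ^ N * pathSeries * rootedTreeSeries_mul_pathSeries
  rw [h1 (n + 1), map_add, coeff_rootedTreeSeries_pow_of_lt n.lt_succ_self, add_zero, map_sum,
    ← Finset.sum_range_reflect]
  refine Finset.sum_congr rfl fun j hj => ?_
  have hj' : j ≤ n := by simpa [Nat.lt_succ_iff] using hj
  rw [show n + 1 - 1 - j = n - j by omega]
  rcases hj'.eq_or_lt with rfl | hlt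
  · simp [coeff_pathSeries]
  · rw [coeff_rootedTreeSeries_pow_mul_pathSeries (by omega) (by omega)]
    rw [show n - (n - j) = j by omega]

theorem coeff_rootedTreeSeries {n : ℕ} (hn : 1 ≤ n) :
    coeff n rootedTreeSeries = (n : ℝ) ^ (n - 1) / n.factorial := by
  obtain ⟨m, rfl⟩ := Nat.exists_eq_add_of_le' hn
  have h := coeff_rootedTreeSeries_pow m 1 le_rfl
  rw [pow_one, add_comm 1 m] at h
  rw [Nat.add_sub_cancel, Nat.factorial_succ]
  have hF := Nat.factorial_pos m
  push_cast at h ⊢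
  field_simp at h ⊢
  linarith

theorem eulerOp_pathSeries_pow (k : ℕ) :
    eulerOp (pathSeries ^ k) = (k : ℝ) • (pathSeries ^ (k + 2) - pathSeries ^ (k + 1)) := by
  cases k with
  | zero => simp
  | succ k =>
    rw [eulerOp_pow, eulerOp_pathSeries]
    push_cast
    congr 1
    ring

theorem coeff_pathSeries_pow_add_two (n k : ℕ) :
    (k : ℝ) * coeff n (pathSeries ^ (k + 2)) =
      n * coeff n (pathSeries ^ k) + k * coeff n (pathSeries ^ (k + 1)) := by
  have h := congrArg (coeff n) (eulerOp_pathSeries_pow k)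
  rw [coeff_eulerOp, PowerSeries.coeff_smul, map_sub, smul_eq_mul] at h
  linarith

theorem coeff_pathSeries_pow_nonneg (n k : ℕ) : 0 ≤ coeff n (pathSeries ^ k) := by
  induction k generalizing n with
  | zero => rw [pow_zero, PowerSeries.coeff_one]; positivity
  | succ k ih =>
    rw [pow_succ, PowerSeries.coeff_mul]
    refine Finset.sum_nonneg fun p _ => mul_nonneg (ih _) ?_
    rw [coeff_pathSeries]
    positivity

theorem coeff_pathSeries_pow_le_succ (n k : ℕ) :
    coeff n (pathSeries ^ k) ≤ coeff n (pathSeries ^ (k + 1)) := by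
  rw [pow_succ, PowerSeries.coeff_mul]
  have h0 := coeff_zero_pathSeries
  refine le_trans ?_ (Finset.single_le_sum (f := fun p : ℕ × ℕ =>
    coeff p.1 (pathSeries ^ k) * coeff p.2 pathSeries) (a := (n, 0)) (fun p _ => mul_nonneg
      (coeff_pathSeries_pow_nonneg _ _) ?_) (by simp))
  · simp only [h0, mul_one, le_refl]
  · simpa using coeff_pathSeries_pow_nonneg p.2 1

/-! ### Asymptotics of the coefficients of the powers of `1 / (1 - T)` -/

theorem log_one_add_le_sub_sq_div {u : ℝ} (hu : 0 ≤ u) :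
    Real.log (1 + u) ≤ u - u ^ 2 / (2 * (1 + u)) := by
  have h1 : (0 : ℝ) < 1 + u := by linarith
  have h := Real.self_le_sinh_iff.2 (Real.log_nonneg (by linarith : (1 : ℝ) ≤ 1 + u))
  rw [Real.sinh_log h1] at h
  refine h.trans (le_of_eq ?_)
  field_simp
  ring

theorem exp_neg_mul_one_add_pow_eq {r y : ℝ} {n : ℕ} (hn : (n : ℝ) = r ^ 2) (hr : 0 < r)
    (hy : 0 ≤ y) : Real.exp (-(r * y)) * (1 + y / r) ^ n =
      Real.exp (r ^ 2 * (Real.log (1 + y / r) - y / r)) := by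
  have h1 : (0 : ℝ) < 1 + y / r := by positivity
  rw [← Real.exp_log (pow_pos h1 n), ← Real.exp_add, Real.log_pow, hn]
  congr 1
  field_simp
  ring

/-- With `r = √n`, this bound and the next one squeeze the integrand to the Gaussian
`exp (-y ^ 2 / 2)` as `n` grows. -/
theorem exp_neg_mul_one_add_pow_le {r y : ℝ} {n : ℕ} (hn : (n : ℝ) = r ^ 2) (hr : 0 < r)
    (hy : 0 ≤ y) : Real.exp (-(r * y)) * (1 + y / r) ^ n ≤
      Real.exp (-(y ^ 2 / (2 * (1 + y / r)))) := by
  rw [exp_neg_mul_one_add_pow_eq hn hr hy, Real.exp_le_exp]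
  have h := log_one_add_le_sub_sq_div (div_nonneg hy hr.le)
  have h2 := mul_le_mul_of_nonneg_left h (sq_nonneg r)
  have h3 : r ^ 2 * ((y / r) ^ 2 / (2 * (1 + y / r))) = y ^ 2 / (2 * (1 + y / r)) := by
    rw [div_pow]; field_simp
  linarith

theorem le_exp_neg_mul_one_add_pow {r y : ℝ} {n : ℕ} (hn : (n : ℝ) = r ^ 2) (hr : 0 < r)
    (hy : 0 ≤ y) : Real.exp (-(y ^ 2 / (2 + y / r))) ≤
      Real.exp (-(r * y)) * (1 + y / r) ^ n := by
  rw [exp_neg_mul_one_add_pow_eq hn hr hy, Real.exp_le_exp]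
  have hu := div_nonneg hy hr.le
  have h := Real.le_log_one_add_of_nonneg hu
  have h2 := mul_le_mul_of_nonneg_left h (sq_nonneg r)
  have h3 : r ^ 2 * (2 * (y / r) / (y / r + 2)) - r ^ 2 * (y / r) = -(y ^ 2 / (2 + y / r)) := by
    field_simp
    ring
  linarith

open MeasureTheory in
/-- Laplace's method for the integral representation of the coefficients of `1 / (1 - T) ^ 2`. -/
theorem tendsto_integral_exp_neg_mul_one_add_pow :
    Tendsto (fun n : ℕ => ∫ y in Set.Ioi (0 : ℝ),
      Real.exp (-(Real.sqrt n * y)) * (1 + y / Real.sqrt n) ^ n) atTop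
      (nhds (Real.sqrt (Real.pi / 2))) := by
  have hG : ∫ y in Set.Ioi (0 : ℝ), Real.exp (-(1 / 2) * y ^ 2) = Real.sqrt (Real.pi / 2) := by
    rw [integral_gaussian_Ioi, div_div_eq_mul_div, div_one,
      show Real.pi * 2 = 2 ^ 2 * (Real.pi / 2) by ring, Real.sqrt_mul (by norm_num),
      Real.sqrt_sq (by norm_num)]
    ring
  rw [← hG]
  have hsq : ∀ n : ℕ, (n : ℝ) = Real.sqrt n ^ 2 := fun n => (Real.sq_sqrt n.cast_nonneg).symm
  -- The majorant comes from `y ^ 2 / (2 * (1 + y / √n)) ≥ y ^ 2 / (2 * (1 + y)) ≥ (y - 1) / 2`.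
  refine tendsto_integral_filter_of_dominated_convergence
    (fun y => Real.exp (1 / 2) * Real.exp (-(1 / 2) * y)) ?_ ?_ ?_ ?_
  · refine Eventually.of_forall fun n => Measurable.aestronglyMeasurable ?_
    fun_prop
  · filter_upwards [eventually_ge_atTop 1] with n hn
    refine (ae_restrict_iff' measurableSet_Ioi).2 (Eventually.of_forall fun y hy => ?_)
    have hy : (0 : ℝ) < y := hy
    have hr : 1 ≤ Real.sqrt n := Real.one_le_sqrt.2 (by exact_mod_cast hn)
    have hr0 : 0 < Real.sqrt n := by linarith
    rw [Real.norm_of_nonneg (by positivity), ← Real.exp_add]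
    refine (exp_neg_mul_one_add_pow_le (hsq n) hr0 hy.le).trans ?_
    rw [Real.exp_le_exp]
    have h1 : y / Real.sqrt n ≤ y := div_le_self hy.le hr
    have h2 : y ^ 2 / (2 * (1 + y)) ≤ y ^ 2 / (2 * (1 + y / Real.sqrt n)) := by gcongr
    have h3 : (y - 1) / 2 ≤ y ^ 2 / (2 * (1 + y)) := by
      rw [div_le_div_iff₀ (by norm_num) (by positivity)]
      nlinarith
    linarith
  · exact (integrableOn_exp_mul_Ioi (by norm_num) 0).const_mul _
  · refine (ae_restrict_iff' measurableSet_Ioi).2 (Eventually.of_forall fun y hy => ?_)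
    have hy : (0 : ℝ) < y := hy
    have hu : Tendsto (fun n : ℕ => y / Real.sqrt n) atTop (nhds 0) :=
      tendsto_const_nhds.div_atTop
        (Real.tendsto_sqrt_atTop.comp tendsto_natCast_atTop_atTop)
    have hlo : Tendsto (fun n : ℕ => Real.exp (-(y ^ 2 / (2 + y / Real.sqrt n)))) atTop
        (nhds (Real.exp (-(1 / 2) * y ^ 2))) := by
      refine (Real.continuous_exp.tendsto _).comp ?_
      rw [show -(1 / 2) * y ^ 2 = -(y ^ 2 / (2 + 0)) by ring]
      exact ((tendsto_const_nhds (x := y ^ 2)).div (hu.const_add 2) (by norm_num)).neg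
    have hhi : Tendsto (fun n : ℕ => Real.exp (-(y ^ 2 / (2 * (1 + y / Real.sqrt n))))) atTop
        (nhds (Real.exp (-(1 / 2) * y ^ 2))) := by
      refine (Real.continuous_exp.tendsto _).comp ?_
      rw [show -(1 / 2) * y ^ 2 = -(y ^ 2 / (2 * (1 + 0))) by ring]
      exact ((tendsto_const_nhds (x := y ^ 2)).div ((hu.const_add 1).const_mul 2)
        (by norm_num)).neg
    refine tendsto_of_tendsto_of_tendsto_of_le_of_le' hlo hhi ?_ ?_
    · filter_upwards [eventually_ge_atTop 1] with n hn
      exact le_exp_neg_mul_one_add_pow (hsq n) (Real.sqrt_pos.2 (by exact_mod_cast hn)) hy.le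
    · filter_upwards [eventually_ge_atTop 1] with n hn
      exact exp_neg_mul_one_add_pow_le (hsq n) (Real.sqrt_pos.2 (by exact_mod_cast hn)) hy.le

open MeasureTheory in
/-- The binomial expansion of the integrand turns the integral into a sum of Gamma integrals, which
is the truncated exponential sum of `coeff_pathSeries_sq`. -/
theorem factorial_mul_coeff_pathSeries_sq {n : ℕ} (hn : 1 ≤ n) :
    (n.factorial : ℝ) * coeff n (pathSeries ^ 2) = (n : ℝ) ^ n * Real.sqrt n *
      ∫ y in Set.Ioi (0 : ℝ), Real.exp (-(Real.sqrt n * y)) * (1 + y / Real.sqrt n) ^ n := by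
  set r := Real.sqrt n with hr
  have hn0 : (0 : ℝ) < n := by exact_mod_cast hn
  have hr0 : 0 < r := Real.sqrt_pos.2 hn0
  have hrn : r * r = n := Real.mul_self_sqrt hn0.le
  have hterm : ∀ j : ℕ, ∫ y in Set.Ioi (0 : ℝ), y ^ j * Real.exp (-(r * y)) =
      (1 / r) ^ (j + 1) * j.factorial := by
    intro j
    have h := Real.integral_rpow_mul_exp_neg_mul_Ioi (a := j + 1) (by positivity) hr0
    rw [Real.Gamma_nat_eq_factorial, add_sub_cancel_right] at h
    rw [show ((j : ℝ) + 1) = ((j + 1 : ℕ) : ℝ) by push_cast; ring, Real.rpow_natCast] at h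
    simpa only [Real.rpow_natCast] using h
  have hint : ∀ j : ℕ, IntegrableOn (fun y : ℝ => y ^ j * Real.exp (-(r * y))) (Set.Ioi 0) := by
    intro j
    have h := integrableOn_rpow_mul_exp_neg_mul_rpow (s := j) (p := 1) (b := r)
      (by have : (0 : ℝ) ≤ j := j.cast_nonneg
          linarith) one_pos hr0
    simpa [Real.rpow_natCast] using h
  have hexp : ∀ y : ℝ, Real.exp (-(r * y)) * (1 + y / r) ^ n = ∑ j ∈ Finset.range (n + 1),
      (n.choose j / r ^ j) * (y ^ j * Real.exp (-(r * y))) := by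
    intro y
    rw [add_comm, add_pow, Finset.mul_sum]
    refine Finset.sum_congr rfl fun j _ => ?_
    rw [one_pow, div_pow]
    ring
  simp_rw [hexp]
  rw [integral_finsetSum _ fun j _ => (hint j).const_mul _, coeff_pathSeries_sq,
    ← Finset.sum_range_reflect, Finset.mul_sum, Finset.mul_sum]
  refine Finset.sum_congr rfl fun j hj => ?_
  have hj' : j ≤ n := by simpa [Nat.lt_succ_iff] using hj
  rw [integral_const_mul, hterm, show n + 1 - 1 - j = n - j by omega]
  have hf : (n.choose j : ℝ) * (j.factorial * (n - j).factorial) = n.factorial := by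
    rw [← mul_assoc]; exact_mod_cast Nat.choose_mul_factorial_mul_factorial hj'
  have hp : (n : ℝ) ^ n = n ^ (n - j) * (r ^ j * r ^ j) := by
    rw [← mul_pow, hrn, ← pow_add]; congr 1; omega
  have h3 := Nat.factorial_pos (n - j)
  rw [← hf, hp, div_pow, one_pow, pow_succ]
  field_simp

/-- The powers of `1 / (1 - T)` have coefficients of successive orders of magnitude
`n ^ (n + (k - 1) / 2) / n!`. -/
theorem tendsto_coeff_pathSeries_pow (k : ℕ) :
    Tendsto (fun n : ℕ => (n.factorial : ℝ) * coeff n (pathSeries ^ (k + 1)) /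
      (n : ℝ) ^ ((n : ℝ) + (k : ℝ) / 2)) atTop
      (nhds (Real.sqrt (2 * Real.pi) /
        ((2 : ℝ) ^ (((k : ℝ) + 1) / 2) * Real.Gamma (((k : ℝ) + 1) / 2)))) := by
  induction k using Nat.twoStepInduction with
  | zero =>
    have hc : Real.sqrt (2 * Real.pi) /
        ((2 : ℝ) ^ (((0 : ℕ) + 1 : ℝ) / 2) * Real.Gamma (((0 : ℕ) + 1 : ℝ) / 2)) = 1 := by
      have hpi := Real.sqrt_pos.2 Real.pi_pos
      rw [Nat.cast_zero, zero_add, Real.Gamma_one_half_eq, ← Real.sqrt_eq_rpow,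
        Real.sqrt_mul (by norm_num)]
      field_simp
    rw [hc]
    refine tendsto_const_nhds.congr' ?_
    filter_upwards [eventually_ge_atTop 1] with n hn
    have hn0 : (0 : ℝ) < n := by exact_mod_cast hn
    rw [zero_add, pow_one, coeff_pathSeries]
    have hF := Nat.factorial_pos n
    simp only [Nat.cast_zero, zero_div, add_zero, Real.rpow_natCast]
    field_simp
  | one =>
    have hc : Real.sqrt (2 * Real.pi) /
        ((2 : ℝ) ^ (((1 : ℕ) + 1 : ℝ) / 2) * Real.Gamma (((1 : ℕ) + 1 : ℝ) / 2)) =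
          Real.sqrt (Real.pi / 2) := by
      rw [show ((1 : ℕ) + 1 : ℝ) / 2 = 1 by norm_num, Real.Gamma_one, Real.rpow_one, mul_one,
        show 2 * Real.pi = 2 ^ 2 * (Real.pi / 2) by ring, Real.sqrt_mul (by norm_num),
        Real.sqrt_sq (by norm_num)]
      ring
    rw [hc]
    refine tendsto_integral_exp_neg_mul_one_add_pow.congr' ?_
    filter_upwards [eventually_ge_atTop 1] with n hn
    have hn0 : (0 : ℝ) < n := by exact_mod_cast hn
    rw [show 1 + 1 = 2 from rfl, factorial_mul_coeff_pathSeries_sq hn, Real.rpow_add hn0,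
      Real.rpow_natCast, Nat.cast_one, ← Real.sqrt_eq_rpow]
    have := Real.sqrt_pos.2 hn0
    field_simp
  | more k ih1 ih2 =>
    have hk : (0 : ℝ) < (k : ℝ) + 1 := by positivity
    have hc : Real.sqrt (2 * Real.pi) / ((2 : ℝ) ^ (((k + 2 : ℕ) + 1 : ℝ) / 2) *
        Real.Gamma (((k + 2 : ℕ) + 1 : ℝ) / 2)) =
          1 / ((k : ℝ) + 1) * (Real.sqrt (2 * Real.pi) /
            ((2 : ℝ) ^ (((k : ℝ) + 1) / 2) * Real.Gamma (((k : ℝ) + 1) / 2))) +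
          Real.sqrt (2 * Real.pi) / ((2 : ℝ) ^ (((k + 1 : ℕ) + 1 : ℝ) / 2) *
            Real.Gamma (((k + 1 : ℕ) + 1 : ℝ) / 2)) * 0 := by
      rw [show ((k + 2 : ℕ) + 1 : ℝ) / 2 = ((k : ℝ) + 1) / 2 + 1 by push_cast; ring,
        Real.Gamma_add_one (by positivity), Real.rpow_add_one (by norm_num)]
      have := Real.Gamma_pos_of_pos (show 0 < ((k : ℝ) + 1) / 2 by positivity)
      have h2 : (0 : ℝ) < 2 ^ (((k : ℝ) + 1) / 2) := by positivity
      field_simp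
      ring
    rw [hc]
    have h0 : Tendsto (fun n : ℕ => (n : ℝ) ^ (-(1 / 2) : ℝ)) atTop (nhds 0) :=
      (tendsto_rpow_neg_atTop (by norm_num)).comp tendsto_natCast_atTop_atTop
    refine ((ih1.const_mul _).add (ih2.mul h0)).congr' ?_
    filter_upwards [eventually_ge_atTop 1] with n hn
    have hn0 : (0 : ℝ) < n := by exact_mod_cast hn
    have h := coeff_pathSeries_pow_add_two n (k + 1)
    have h1 : (n : ℝ) ^ ((n : ℝ) + ((k + 2 : ℕ) : ℝ) / 2) =
        (n : ℝ) ^ ((n : ℝ) + (k : ℝ) / 2) * n := by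
      rw [← Real.rpow_add_one hn0.ne']; congr 1; push_cast; ring
    have h2 : (n : ℝ) ^ ((n : ℝ) + ((k + 1 : ℕ) : ℝ) / 2) * (n : ℝ) ^ (1 / 2 : ℝ) =
        (n : ℝ) ^ ((n : ℝ) + (k : ℝ) / 2) * n := by
      rw [← Real.rpow_add_one hn0.ne', ← Real.rpow_add hn0]; congr 1; push_cast; ring
    rw [h1, Real.rpow_neg hn0.le]
    have h3 : ∀ a : ℝ, a / (n : ℝ) ^ ((n : ℝ) + ((k + 1 : ℕ) : ℝ) / 2) *
        ((n : ℝ) ^ (1 / 2 : ℝ))⁻¹ = a / ((n : ℝ) ^ ((n : ℝ) + (k : ℝ) / 2) * n) := by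
      intro a
      rw [← h2]
      field_simp
    rw [h3]
    have h4 : (0 : ℝ) < (n : ℝ) ^ ((n : ℝ) + (k : ℝ) / 2) := by positivity
    push_cast at h
    rw [show k + 2 + 1 = k + 1 + 2 by ring]
    field_simp
    linear_combination -h

/-! ### Expansion of the generating functions in powers of `1 / (1 - T)` -/

/-- The power series whose coefficients are bounded by a constant multiple of those of
`1 / (1 - T) ^ k`. -/
noncomputable def pathBounded (k : ℕ) : Submodule ℝ (PowerSeries ℝ) where
  carrier := {f | ∃ M : ℝ, ∀ n, |coeff n f| ≤ M * coeff n (pathSeries ^ k)}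
  zero_mem' := ⟨0, by simp⟩
  add_mem' := by
    rintro f g ⟨M, hM⟩ ⟨N, hN⟩
    refine ⟨M + N, fun n => ?_⟩
    rw [map_add, add_mul]
    exact (abs_add_le _ _).trans (add_le_add (hM n) (hN n))
  smul_mem' := by
    rintro c f ⟨M, hM⟩
    refine ⟨|c| * M, fun n => ?_⟩
    rw [PowerSeries.coeff_smul, smul_eq_mul, abs_mul, mul_assoc]
    exact mul_le_mul_of_nonneg_left (hM n) (abs_nonneg c)

theorem exists_nonneg_bound {k : ℕ} {f : PowerSeries ℝ} (hf : f ∈ pathBounded k) :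
    ∃ M : ℝ, 0 ≤ M ∧ ∀ n, |coeff n f| ≤ M * coeff n (pathSeries ^ k) := by
  obtain ⟨M, hM⟩ := hf
  exact ⟨max M 0, le_max_right _ _, fun n => (hM n).trans
    (mul_le_mul_of_nonneg_right (le_max_left _ _) (coeff_pathSeries_pow_nonneg n k))⟩

theorem pathSeries_pow_mem (k : ℕ) : pathSeries ^ k ∈ pathBounded k :=
  ⟨1, fun n => by rw [one_mul, abs_of_nonneg (coeff_pathSeries_pow_nonneg n k)]⟩

theorem pathBounded_mono : Monotone pathBounded := by
  refine monotone_nat_of_le_succ fun k f hf => ?_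
  obtain ⟨M, hM0, hM⟩ := exists_nonneg_bound hf
  exact ⟨M, fun n => (hM n).trans
    (mul_le_mul_of_nonneg_left (coeff_pathSeries_pow_le_succ n k) hM0)⟩

theorem mul_mem_pathBounded {j k : ℕ} {f g : PowerSeries ℝ} (hf : f ∈ pathBounded j)
    (hg : g ∈ pathBounded k) : f * g ∈ pathBounded (j + k) := by
  obtain ⟨M, hM0, hM⟩ := exists_nonneg_bound hf
  obtain ⟨N, hN0, hN⟩ := exists_nonneg_bound hg
  refine ⟨M * N, fun n => ?_⟩
  rw [pow_add, PowerSeries.coeff_mul, PowerSeries.coeff_mul, Finset.mul_sum]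
  refine (Finset.abs_sum_le_sum_abs _ _).trans (Finset.sum_le_sum fun p _ => ?_)
  rw [abs_mul]
  refine (mul_le_mul (hM p.1) (hN p.2) (abs_nonneg _)
    (mul_nonneg hM0 (coeff_pathSeries_pow_nonneg _ _))).trans (le_of_eq ?_)
  ring

theorem eulerOp_mem_pathBounded {k : ℕ} {f : PowerSeries ℝ} (hf : f ∈ pathBounded k) :
    eulerOp f ∈ pathBounded (k + 2) := by
  obtain ⟨M, hM0, hM⟩ := exists_nonneg_bound hf
  refine ⟨M * k, fun n => ?_⟩
  have h := coeff_pathSeries_pow_add_two n k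
  have h1 : 0 ≤ (k : ℝ) * coeff n (pathSeries ^ (k + 1)) :=
    mul_nonneg k.cast_nonneg (coeff_pathSeries_pow_nonneg _ _)
  rw [coeff_eulerOp, abs_mul, Nat.abs_cast, mul_assoc]
  calc (n : ℝ) * |coeff n f| ≤ n * (M * coeff n (pathSeries ^ k)) :=
        mul_le_mul_of_nonneg_left (hM n) n.cast_nonneg
    _ = M * (n * coeff n (pathSeries ^ k)) := by ring
    _ ≤ M * (k * coeff n (pathSeries ^ (k + 2))) := mul_le_mul_of_nonneg_left (by linarith) hM0

theorem coeff_pathSeries_pow_add_two_le {n k : ℕ} (hn : 1 ≤ n) (hk : 2 ≤ k) :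
    coeff n (pathSeries ^ (k + 2)) ≤ 3 * n * coeff n (pathSeries ^ k) := by
  obtain ⟨j, rfl⟩ := Nat.exists_eq_add_of_le' hk
  have h1 := coeff_pathSeries_pow_add_two n (j + 1)
  have h2 := coeff_pathSeries_pow_add_two n (j + 2)
  have h3 := coeff_pathSeries_pow_le_succ n (j + 1)
  have h0 := coeff_pathSeries_pow_nonneg n (j + 2)
  have hn' : (1 : ℝ) ≤ n := by exact_mod_cast hn
  have hj : (0 : ℝ) ≤ j := j.cast_nonneg
  simp only [show j + 1 + 2 = j + 3 from rfl, show j + 1 + 1 = j + 2 from rfl,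
    show j + 2 + 2 = j + 4 from rfl] at *
  push_cast at h1 h2
  set a := coeff n (pathSeries ^ (j + 1))
  set b := coeff n (pathSeries ^ (j + 2))
  set c := coeff n (pathSeries ^ (j + 3))
  set d := coeff n (pathSeries ^ (j + 4))
  have hc : c ≤ 2 * n * b := by
    have e1 : (j + 1) * c ≤ (j + 1) * (2 * n * b) := by
      have e2 : n * a ≤ n * b := mul_le_mul_of_nonneg_left h3 (by linarith)
      have e3 : 0 ≤ (j + 1) * ((n - 1) * b) := by
        have := sub_nonneg.2 hn'
        positivity
      have e4 : 0 ≤ j * (n * b) := by positivity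
      linarith
    exact le_of_mul_le_mul_left e1 (by linarith)
  have e1 : (j + 2) * d ≤ (j + 2) * (3 * n * b) := by
    have e2 : (j + 2) * c ≤ (j + 2) * (2 * n * b) := mul_le_mul_of_nonneg_left hc (by linarith)
    have e4 : 0 ≤ (j + 1) * (n * b) := by positivity
    linarith
  exact le_of_mul_le_mul_left e1 (by linarith)

/-- Inverting the Euler operator divides the coefficient of `z ^ n` by `n`, which lowers the order
by two. -/
theorem mem_pathBounded_of_eulerOp_mem {k : ℕ} (hk : 2 ≤ k) {f : PowerSeries ℝ}
    (h0 : coeff 0 f = 0) (hf : eulerOp f ∈ pathBounded (k + 2)) : f ∈ pathBounded k := by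
  obtain ⟨M, hM0, hM⟩ := exists_nonneg_bound hf
  refine ⟨3 * M, fun n => ?_⟩
  rcases Nat.eq_zero_or_pos n with rfl | hn
  · rw [h0, abs_zero]
    exact mul_nonneg (by linarith) (coeff_pathSeries_pow_nonneg _ _)
  have hn' : (0 : ℝ) < n := by exact_mod_cast hn
  have h := (hM n).trans (mul_le_mul_of_nonneg_left (coeff_pathSeries_pow_add_two_le hn hk) hM0)
  rw [coeff_eulerOp, abs_mul, Nat.abs_cast] at h
  refine le_of_mul_le_mul_left (h.trans (le_of_eq ?_)) hn'
  ring

/-- Leading terms in powers of `1 / (1 - T)` multiply. -/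
theorem mul_sub_smul_pathSeries_mem {j k : ℕ} {c d : ℝ} {f g : PowerSeries ℝ}
    (hf : f - c • pathSeries ^ (j + 1) ∈ pathBounded j)
    (hg : g - d • pathSeries ^ (k + 1) ∈ pathBounded k) :
    f * g - (c * d) • pathSeries ^ (j + k + 2) ∈ pathBounded (j + k + 1) := by
  have hg' : g ∈ pathBounded (k + 1) := by
    have := add_mem (pathBounded_mono k.le_succ hg)
      ((pathBounded (k + 1)).smul_mem d (pathSeries_pow_mem (k + 1)))
    simpa using this
  have h1 := mul_mem_pathBounded hf hg'
  have h2 := mul_mem_pathBounded ((pathBounded (j + 1)).smul_mem c (pathSeries_pow_mem (j + 1))) hg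
  rw [← add_assoc] at h1
  rw [show j + 1 + k = j + k + 1 by ring] at h2
  convert add_mem h1 h2 using 1
  rw [mul_smul, show j + k + 2 = (j + 1) + (k + 1) by ring, pow_add pathSeries (j + 1) (k + 1)]
  simp only [PowerSeries.smul_eq_C_mul]
  ring

theorem eulerOp_sub_smul_pathSeries_mem {k : ℕ} {c : ℝ} {f : PowerSeries ℝ}
    (hf : f - c • pathSeries ^ (k + 1) ∈ pathBounded k) :
    eulerOp f - ((k + 1) * c) • pathSeries ^ (k + 3) ∈ pathBounded (k + 2) := by
  have h1 := eulerOp_mem_pathBounded hf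
  rw [map_sub, Derivation.map_smul, eulerOp_pathSeries_pow] at h1
  have h2 := (pathBounded (k + 2)).smul_mem (c * (k + 1)) (pathSeries_pow_mem (k + 2))
  convert sub_mem h1 h2 using 1
  push_cast
  simp only [PowerSeries.smul_eq_C_mul, map_mul]
  rw [show k + 1 + 2 = k + 3 from rfl, show k + 1 + 1 = k + 2 from rfl]
  ring

theorem C_one_half_mul_two : PowerSeries.C (1 / 2 : ℝ) * 2 = 1 := by
  rw [← map_ofNat (PowerSeries.C (R := ℝ)) 2, ← map_mul]
  norm_num

theorem eulerOp_excessSeries_one :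
    eulerOp (excessSeries 1) = (1 / 2 : ℝ) • (pathSeries ^ 2 - pathSeries) := by
  have h := eulerOp_excessSeries_succ 0
  rw [Nat.cast_zero, zero_smul, add_zero] at h
  simp only [Finset.Nat.antidiagonal_succ, Finset.Nat.antidiagonal_zero, Finset.map_singleton,
    Finset.sum_cons, Finset.sum_singleton, Function.Embedding.prodMap, Prod.map,
    Function.Embedding.coeFn_mk, Function.Embedding.refl_apply, zero_add] at h
  change _ = _ • (eulerOp rootedTreeSeries + (rootedTreeSeries * eulerOp (excessSeries 1) +
    eulerOp (excessSeries 1) * rootedTreeSeries)) at h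
  rw [eulerOp_rootedTreeSeries] at h
  simp only [PowerSeries.smul_eq_C_mul] at h ⊢
  linear_combination pathSeries * h - eulerOp (excessSeries 1) * pathSeries_mul +
    PowerSeries.C (1 / 2 : ℝ) * pathSeries * rootedTreeSeries_mul_pathSeries +
    pathSeries * rootedTreeSeries * eulerOp (excessSeries 1) * C_one_half_mul_two

theorem eulerOp_excessSeries_add_two (q : ℕ) :
    eulerOp (excessSeries (q + 2)) + (q + 1 : ℝ) • (pathSeries * excessSeries (q + 2)) =
      pathSeries * (1 / 2 : ℝ) • (eulerOp (eulerOp (excessSeries (q + 1))) +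
        ∑ a ∈ antidiagonal q,
          eulerOp (excessSeries (a.1 + 1)) * eulerOp (excessSeries (a.2 + 1))) := by
  have h := eulerOp_excessSeries_succ (q + 1)
  rw [Finset.Nat.antidiagonal_succ_succ', Finset.sum_cons, Finset.sum_cons, Finset.sum_map] at h
  change _ = _ • (_ + (rootedTreeSeries * eulerOp (excessSeries (q + 2)) +
    (eulerOp (excessSeries (q + 2)) * rootedTreeSeries + ∑ a ∈ antidiagonal q,
      eulerOp (excessSeries (a.1 + 1)) * eulerOp (excessSeries (a.2 + 1))))) at h
  push_cast at h
  simp only [PowerSeries.smul_eq_C_mul] at h ⊢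
  linear_combination pathSeries * h - eulerOp (excessSeries (q + 2)) * pathSeries_mul +
    pathSeries * rootedTreeSeries * eulerOp (excessSeries (q + 2)) * C_one_half_mul_two

theorem coeff_excessSeries_nonneg (s n : ℕ) : 0 ≤ coeff n (excessSeries s) := by
  rw [coeff_excessSeries]
  exact div_nonneg (connectedMultigraphNumber_nonneg _ _) (Nat.cast_nonneg _)

/-- The generating function of connected multigraphs of excess `q ≥ 0`, with a marked vertex, is
`d q / (1 - T) ^ (3 q + 2)` up to terms of lower order. Since all coefficients are nonnegative, the
recurrence first bounds the term that carries the generating function without marked vertex, and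
then shows that this term is negligible. -/
theorem eulerOp_excessSeries_sub_mem {d : ℕ → ℝ} (h0 : d 0 = 1 / 2)
    (hd : ∀ q, d (q + 1) = 1 / 2 * ((3 * q + 2) * d q + ∑ a ∈ antidiagonal q, d a.1 * d a.2))
    (q : ℕ) :
    eulerOp (excessSeries (q + 1)) - d q • pathSeries ^ (3 * q + 2) ∈ pathBounded (3 * q + 1) := by
  induction q using Nat.strong_induction_on with
  | _ q ih =>
  rcases q with _ | q
  · rw [h0, zero_add, eulerOp_excessSeries_one, mul_zero, zero_add, zero_add, smul_sub,
      sub_sub_cancel_left]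
    have := pathSeries_pow_mem 1
    rw [pow_one] at this
    exact neg_mem (Submodule.smul_mem _ _ this)
  · set R := (1 / 2 : ℝ) • (eulerOp (eulerOp (excessSeries (q + 1))) + ∑ a ∈ antidiagonal q,
      eulerOp (excessSeries (a.1 + 1)) * eulerOp (excessSeries (a.2 + 1))) with hR
    have hrec := eulerOp_excessSeries_add_two q
    rw [← hR] at hrec
    have hR1 : R - d (q + 1) • pathSeries ^ (3 * q + 4) ∈ pathBounded (3 * q + 3) := by
      have e1 := eulerOp_sub_smul_pathSeries_mem (ih q q.lt_succ_self)
      have e2 : ∑ a ∈ antidiagonal q,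
          (eulerOp (excessSeries (a.1 + 1)) * eulerOp (excessSeries (a.2 + 1)) -
            (d a.1 * d a.2) • pathSeries ^ (3 * q + 4)) ∈ pathBounded (3 * q + 3) := by
        refine sum_mem fun a ha => ?_
        rw [Finset.HasAntidiagonal.mem_antidiagonal] at ha
        have := mul_sub_smul_pathSeries_mem (ih a.1 (by omega)) (ih a.2 (by omega))
        rwa [show 3 * a.1 + 1 + (3 * a.2 + 1) + 2 = 3 * q + 4 by omega,
          show 3 * a.1 + 1 + (3 * a.2 + 1) + 1 = 3 * q + 3 by omega] at this
      have e3 := Submodule.smul_mem _ (1 / 2 : ℝ) (add_mem e1 e2)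
      convert e3 using 1
      rw [hR, hd, Finset.sum_sub_distrib, ← Finset.sum_smul]
      push_cast
      rw [show 3 * q + 1 + 3 = 3 * q + 4 by ring]
      module
    have hR2 : R ∈ pathBounded (3 * q + 4) := by
      have := add_mem (pathBounded_mono (3 * q + 3).le_succ hR1)
        ((pathBounded (3 * q + 4)).smul_mem (d (q + 1)) (pathSeries_pow_mem (3 * q + 4)))
      simpa using this
    have hx : pathSeries ∈ pathBounded 1 := by simpa using pathSeries_pow_mem 1
    -- The other term on the left of the recurrence has nonnegative coefficients and can be dropped.
    have hF : eulerOp (excessSeries (q + 2)) ∈ pathBounded (3 * q + 3 + 2) := by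
      obtain ⟨M, hM⟩ := mul_mem_pathBounded hx hR2
      refine ⟨M, fun n => ?_⟩
      have e1 := congrArg (coeff n) hrec
      rw [map_add, PowerSeries.coeff_smul, smul_eq_mul] at e1
      have e2 : 0 ≤ (q + 1 : ℝ) * coeff n (pathSeries * excessSeries (q + 2)) := by
        rw [PowerSeries.coeff_mul]
        refine mul_nonneg (by positivity) (Finset.sum_nonneg fun p _ => mul_nonneg ?_
          (coeff_excessSeries_nonneg _ _))
        simpa using coeff_pathSeries_pow_nonneg p.1 1
      have e3 := hM n
      rw [show 1 + (3 * q + 4) = 3 * q + 3 + 2 by ring] at e3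
      rw [coeff_eulerOp] at e1 ⊢
      rw [abs_of_nonneg (mul_nonneg n.cast_nonneg (coeff_excessSeries_nonneg _ _))]
      linarith [le_abs_self (coeff n (pathSeries * R))]
    have hW := mem_pathBounded_of_eulerOp_mem (by omega) (coeff_zero_excessSeries _) hF
    have e1 := mul_mem_pathBounded hx hR1
    have e2 := Submodule.smul_mem _ (q + 1 : ℝ) (mul_mem_pathBounded hx hW)
    have e3 := sub_mem e1 e2
    rw [show 1 + (3 * q + 3) = 3 * (q + 1) + 1 by ring] at e3
    convert e3 using 1
    rw [show 3 * (q + 1) + 2 = 3 * q + 4 + 1 by ring, pow_succ,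
      show q + 1 + 1 = q + 2 from rfl]
    simp only [PowerSeries.smul_eq_C_mul] at hrec ⊢
    linear_combination hrec

/-! ### The logarithm of the series of cubic multigraphs -/

/-- The identity `f * D (log f) = D f` for the formal logarithm. -/
theorem eulerOp_logOf {f : PowerSeries ℝ} (hf : PowerSeries.constantCoeff f = 1) :
    f * eulerOp (PowerSeries.logOf f) = eulerOp f := by
  have hs : PowerSeries.HasSubst (f - 1) :=
    PowerSeries.HasSubst.of_constantCoeff_zero' (by simp [hf])
  have h1 : (1 + PowerSeries.X) * PowerSeries.derivative ℝ (PowerSeries.log ℝ) = 1 := by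
    rw [PowerSeries.deriv_log, add_mul, one_mul]
    ext n
    cases n with
    | zero => simp
    | succ n => simp [PowerSeries.coeff_succ_X_mul, PowerSeries.coeff_one, pow_succ]
  have h2 := congrArg (PowerSeries.subst (f - 1)) h1
  have hone : PowerSeries.subst (f - 1) (1 : PowerSeries ℝ) = (1 : PowerSeries ℝ) := by
    rw [← PowerSeries.coe_substAlgHom hs, map_one]
  rw [PowerSeries.subst_mul hs, PowerSeries.subst_add hs, PowerSeries.subst_X hs, hone,
    add_sub_cancel] at h2
  simp only [eulerOp, Derivation.coe_smul, Pi.smul_apply, smul_eq_mul]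
  rw [PowerSeries.logOf_eq, PowerSeries.derivative_subst hs, map_sub]
  have h3 : PowerSeries.derivative ℝ (1 : PowerSeries ℝ) = 0 := PowerSeries.derivative_one
  rw [h3]
  linear_combination PowerSeries.X * PowerSeries.derivative ℝ f * h2

theorem coeff_cubicSeries_two_mul (l : ℕ) : coeff (2 * l) cubicSeries =
    ((6 * l).factorial : ℝ) / (288 ^ l * ((3 * l).factorial : ℝ)) / ((2 * l).factorial : ℝ) := by
  rw [cubicSeries, PowerSeries.coeff_mk, if_pos (even_two_mul l),
    Nat.mul_div_cancel_left l two_pos]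

theorem constantCoeff_cubicSeries : PowerSeries.constantCoeff cubicSeries = 1 := by
  rw [← PowerSeries.coeff_zero_eq_constantCoeff_apply, ← mul_zero 2, coeff_cubicSeries_two_mul]
  simp

theorem coeff_cubicSeries_add_two (k : ℕ) :
    1 / 2 * (((k + 2 : ℕ) : ℝ) * coeff (k + 2) cubicSeries) =
      (3 / 8 * (k : ℝ) ^ 2 + 3 / 4 * k + 5 / 24) * coeff k cubicSeries := by
  rcases Nat.even_or_odd' k with ⟨l, rfl | rfl⟩
  · rw [show 2 * l + 2 = 2 * (l + 1) by ring, coeff_cubicSeries_two_mul,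
      coeff_cubicSeries_two_mul]
    rw [show 6 * (l + 1) = 6 * l + 1 + 1 + 1 + 1 + 1 + 1 by ring,
      show 3 * (l + 1) = 3 * l + 1 + 1 + 1 by ring, show 2 * (l + 1) = 2 * l + 1 + 1 by ring]
    simp only [Nat.factorial_succ, pow_succ]
    have h1 := Nat.factorial_pos (6 * l)
    have h2 := Nat.factorial_pos (3 * l)
    have h3 := Nat.factorial_pos (2 * l)
    push_cast
    field_simp
    ring
  · have h : ∀ j : ℕ, coeff (2 * j + 1) cubicSeries = 0 := by
      intro j
      rw [cubicSeries, PowerSeries.coeff_mk, if_neg (by simp)]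
    rw [show 2 * l + 1 + 2 = 2 * (l + 1) + 1 by ring, h, h]
    simp

/-- The linear differential equation satisfied by the series of cubic multigraphs. -/
theorem eulerOp_cubicSeries : (1 / 2 : ℝ) • eulerOp cubicSeries =
    PowerSeries.X ^ 2 * ((3 / 8 : ℝ) • eulerOp (eulerOp cubicSeries) +
      (3 / 4 : ℝ) • eulerOp cubicSeries + (5 / 24 : ℝ) • cubicSeries) := by
  ext n
  rw [PowerSeries.coeff_X_pow_mul']
  simp only [PowerSeries.coeff_smul, coeff_eulerOp, map_add, smul_eq_mul]
  match n with
  | 0 => simp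
  | 1 =>
    have : coeff 1 cubicSeries = 0 := by
      rw [cubicSeries, PowerSeries.coeff_mk, if_neg (by decide)]
    simp [this]
  | n + 2 =>
    rw [if_pos (by omega), coeff_cubicSeries_add_two, Nat.add_sub_cancel]
    ring

/-- The logarithmic derivative of the series of cubic multigraphs satisfies a Riccati equation. -/
theorem riccati_cubicSeries : (1 / 2 : ℝ) • eulerOp (PowerSeries.logOf cubicSeries) =
    PowerSeries.X ^ 2 * ((3 / 8 : ℝ) • (eulerOp (eulerOp (PowerSeries.logOf cubicSeries)) +
      eulerOp (PowerSeries.logOf cubicSeries) ^ 2) +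
      (3 / 4 : ℝ) • eulerOp (PowerSeries.logOf cubicSeries) + PowerSeries.C (5 / 24 : ℝ)) := by
  set M := eulerOp (PowerSeries.logOf cubicSeries)
  have h1 : eulerOp cubicSeries = cubicSeries * M := (eulerOp_logOf constantCoeff_cubicSeries).symm
  have h2 : eulerOp (eulerOp cubicSeries) = cubicSeries * (eulerOp M + M ^ 2) := by
    rw [h1, eulerOp_mul, h1]
    ring
  have hE : cubicSeries ≠ 0 := by
    intro h
    have := constantCoeff_cubicSeries
    rw [h] at this
    simp at this
  have h := eulerOp_cubicSeries
  rw [h2, h1] at h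
  apply mul_left_cancel₀ hE
  simp only [PowerSeries.smul_eq_C_mul] at h ⊢
  linear_combination h

theorem riccati_coeff (k : ℕ) :
    1 / 2 * coeff (k + 2) (eulerOp (PowerSeries.logOf cubicSeries)) =
      3 / 8 * (k * coeff k (eulerOp (PowerSeries.logOf cubicSeries)) +
        ∑ p ∈ antidiagonal k, coeff p.1 (eulerOp (PowerSeries.logOf cubicSeries)) *
          coeff p.2 (eulerOp (PowerSeries.logOf cubicSeries))) +
      3 / 4 * coeff k (eulerOp (PowerSeries.logOf cubicSeries)) + if k = 0 then 5 / 24 else 0 := by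
  have h := congrArg (coeff (k + 2)) riccati_cubicSeries
  rw [PowerSeries.coeff_X_pow_mul', if_pos (by omega), Nat.add_sub_cancel] at h
  simp only [PowerSeries.coeff_smul, map_add, smul_eq_mul, sq, PowerSeries.coeff_mul] at h
  rw [h, coeff_eulerOp k (eulerOp _), PowerSeries.coeff_C]

theorem coeff_eulerOp_logOf_cubicSeries_of_odd {k : ℕ} (hk : Odd k) :
    coeff k (eulerOp (PowerSeries.logOf cubicSeries)) = 0 := by
  induction k using Nat.strong_induction_on with
  | _ k ih =>
  match k, hk with
  | 1, _ =>
    have h := congrArg (coeff 1) riccati_cubicSeries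
    rw [PowerSeries.coeff_X_pow_mul', if_neg (by norm_num), PowerSeries.coeff_smul,
      smul_eq_mul] at h
    linarith
  | k + 2, hk =>
    have hk' : Odd k := by
      rw [Nat.odd_add] at hk
      exact hk.2 even_two
    have h := riccati_coeff k
    rw [ih k (by omega) hk', if_neg (by rintro rfl; simp at hk'), Finset.sum_eq_zero] at h
    · linarith
    · rintro ⟨i, j⟩ hij
      rw [Finset.HasAntidiagonal.mem_antidiagonal] at hij
      simp only at hij ⊢
      rw [← hij, Nat.odd_add] at hk'
      by_cases hi : Odd i
      · rw [ih i (by omega) hi, zero_mul]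
      · have hj : Odd j := by
          by_contra hj
          exact hi (hk'.2 (Nat.not_odd_iff_even.1 hj))
        rw [ih j (by omega) hj, mul_zero]

/-- The leading coefficient of the generating function, with a marked vertex, of connected
multigraphs of excess `q`, expressed through the logarithm of the series of cubic multigraphs. -/
noncomputable def leadingConstant (q : ℕ) : ℝ :=
  if q = 0 then 1 / 2 else 3 * q * coeff (2 * q) (PowerSeries.logOf cubicSeries)

theorem leadingConstant_zero : leadingConstant 0 = 1 / 2 := if_pos rfl

theorem leadingConstant_eq (q : ℕ) : leadingConstant q = (if q = 0 then 1 / 2 else 0) +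
    3 / 2 * coeff (2 * q) (eulerOp (PowerSeries.logOf cubicSeries)) := by
  rw [leadingConstant, coeff_eulerOp]
  split_ifs with h
  · simp [h]
  · push_cast
    ring

theorem leadingConstant_succ (q : ℕ) : leadingConstant (q + 1) =
    1 / 2 * ((3 * q + 2) * leadingConstant q +
      ∑ a ∈ antidiagonal q, leadingConstant a.1 * leadingConstant a.2) := by
  set m : ℕ → ℝ := fun k => coeff k (eulerOp (PowerSeries.logOf cubicSeries)) with hm
  have hS : ∑ p ∈ antidiagonal (2 * q), m p.1 * m p.2 =
      ∑ a ∈ antidiagonal q, m (2 * a.1) * m (2 * a.2) := by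
    symm
    refine Finset.sum_of_injOn (fun a => (2 * a.1, 2 * a.2)) ?_ ?_ ?_ ?_
    · rintro ⟨a, b⟩ - ⟨a', b'⟩ - h
      simp only [Prod.mk.injEq] at h ⊢
      omega
    · rintro ⟨a, b⟩ h
      simp only [Finset.mem_coe, Finset.HasAntidiagonal.mem_antidiagonal] at h ⊢
      omega
    · rintro ⟨i, j⟩ h hn
      rw [Finset.HasAntidiagonal.mem_antidiagonal] at h
      simp only at h ⊢
      rcases Nat.even_or_odd' i with ⟨a, rfl | rfl⟩
      · refine absurd ⟨(a, q - a), ?_, ?_⟩ hn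
        · simp only [Finset.mem_coe, Finset.HasAntidiagonal.mem_antidiagonal]
          omega
        · simp only [Prod.mk.injEq]
          exact ⟨trivial, by omega⟩
      · rw [show m (2 * a + 1) = 0 from
          coeff_eulerOp_logOf_cubicSeries_of_odd (odd_two_mul_add_one a), zero_mul]
    · intros
      rfl
  have hD : ∑ a ∈ antidiagonal q, leadingConstant a.1 * leadingConstant a.2 =
      (if q = 0 then 1 / 4 else 0) + 3 / 2 * m (2 * q) +
        9 / 4 * ∑ a ∈ antidiagonal q, m (2 * a.1) * m (2 * a.2) := by
    set N : PowerSeries ℝ := PowerSeries.mk fun a => m (2 * a) with hN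
    have e1 : PowerSeries.mk leadingConstant = PowerSeries.C (1 / 2 : ℝ) + (3 / 2 : ℝ) • N := by
      ext a
      rw [PowerSeries.coeff_mk, leadingConstant_eq, map_add, PowerSeries.coeff_smul,
        PowerSeries.coeff_C, hN, PowerSeries.coeff_mk, smul_eq_mul]
    have e2 : PowerSeries.mk leadingConstant * PowerSeries.mk leadingConstant =
        PowerSeries.C (1 / 4 : ℝ) + (3 / 2 : ℝ) • N + (9 / 4 : ℝ) • (N * N) := by
      rw [e1]
      simp only [PowerSeries.smul_eq_C_mul]
      rw [show (1 / 4 : ℝ) = 1 / 2 * (1 / 2) by norm_num,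
        show (9 / 4 : ℝ) = 3 / 2 * (3 / 2) by norm_num, map_mul, map_mul]
      have := C_one_half_mul_two
      linear_combination PowerSeries.C (3 / 2 : ℝ) * N * this
    have e3 := congrArg (coeff q) e2
    simp only [map_add, PowerSeries.coeff_smul, PowerSeries.coeff_mul, PowerSeries.coeff_mk,
      PowerSeries.coeff_C, smul_eq_mul, hN] at e3
    exact e3
  have hr := riccati_coeff (2 * q)
  change 1 / 2 * m (2 * q + 2) = 3 / 8 * (((2 * q : ℕ) : ℝ) * m (2 * q) +
    ∑ p ∈ antidiagonal (2 * q), m p.1 * m p.2) + 3 / 4 * m (2 * q) + _ at hr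
  rw [hS] at hr
  rw [hD, leadingConstant_eq, leadingConstant_eq, if_neg q.succ_ne_zero]
  change 0 + 3 / 2 * m (2 * q + 2) = 1 / 2 * ((3 * q + 2) * (_ + 3 / 2 * m (2 * q)) + _)
  push_cast at hr
  rcases Nat.eq_zero_or_pos q with rfl | hq
  · simp only [if_true, mul_zero, Nat.cast_zero] at hr ⊢
    linear_combination 3 * hr
  · rw [if_neg (by omega)] at hr
    rw [if_neg hq.ne', if_neg hq.ne']
    linear_combination 3 * hr

theorem leadingConstant_pos (q : ℕ) : 0 < leadingConstant q := by
  induction q using Nat.strong_induction_on with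
  | _ q ih =>
  rcases q with _ | q
  · rw [leadingConstant_zero]
    norm_num
  · rw [leadingConstant_succ]
    have h1 := ih q q.lt_succ_self
    have h2 : 0 ≤ ∑ a ∈ antidiagonal q, leadingConstant a.1 * leadingConstant a.2 := by
      refine Finset.sum_nonneg fun a ha => ?_
      rw [Finset.HasAntidiagonal.mem_antidiagonal] at ha
      exact (mul_pos (ih a.1 (by omega)) (ih a.2 (by omega))).le
    positivity

/-! ### Asymptotics of the number of connected multigraphs -/

theorem tendsto_coeff_eulerOp_excessSeries (q : ℕ) :
    Tendsto (fun n : ℕ => (n.factorial : ℝ) * coeff n (eulerOp (excessSeries (q + 1))) /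
      (n : ℝ) ^ ((n : ℝ) + (3 * q + 1) / 2)) atTop
      (nhds (leadingConstant q * (Real.sqrt (2 * Real.pi) /
        ((2 : ℝ) ^ ((3 * q + 2 : ℝ) / 2) * Real.Gamma ((3 * q + 2 : ℝ) / 2))))) := by
  obtain ⟨M, hM⟩ := eulerOp_excessSeries_sub_mem leadingConstant_zero leadingConstant_succ q
  set R := eulerOp (excessSeries (q + 1)) - leadingConstant q • pathSeries ^ (3 * q + 2) with hR
  have h1 := tendsto_coeff_pathSeries_pow (3 * q + 1)
  have h2 := tendsto_coeff_pathSeries_pow (3 * q)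
  push_cast at h1 h2
  rw [show (3 * q + 1 + 1 : ℝ) = 3 * q + 2 by ring] at h1
  have h0 : Tendsto (fun n : ℕ => (n : ℝ) ^ (-(1 / 2) : ℝ)) atTop (nhds 0) :=
    (tendsto_rpow_neg_atTop (by norm_num)).comp tendsto_natCast_atTop_atTop
  have h3 : Tendsto (fun n : ℕ => (n.factorial : ℝ) * coeff n R /
      (n : ℝ) ^ ((n : ℝ) + (3 * q + 1) / 2)) atTop (nhds 0) := by
    have h4 := (h2.mul h0).const_mul M
    rw [mul_zero, mul_zero] at h4
    refine squeeze_zero_norm' ?_ h4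
    filter_upwards [eventually_ge_atTop 1] with n hn
    have hn0 : (0 : ℝ) < n := by exact_mod_cast hn
    have h5 : (n : ℝ) ^ ((n : ℝ) + (3 * q + 1) / 2) =
        (n : ℝ) ^ ((n : ℝ) + 3 * q / 2) * (n : ℝ) ^ (1 / 2 : ℝ) := by
      rw [← Real.rpow_add hn0]
      congr 1
      ring
    rw [norm_div, norm_mul, Real.norm_eq_abs, Real.norm_eq_abs, Real.norm_eq_abs, Nat.abs_cast,
      abs_of_pos (by positivity : (0 : ℝ) < (n : ℝ) ^ ((n : ℝ) + (3 * q + 1) / 2)), h5,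
      Real.rpow_neg hn0.le]
    have hp : (0 : ℝ) < (n : ℝ) ^ ((n : ℝ) + 3 * q / 2) := by positivity
    have hp' : (0 : ℝ) < (n : ℝ) ^ (1 / 2 : ℝ) := by positivity
    calc (n.factorial : ℝ) * |coeff n R| /
          ((n : ℝ) ^ ((n : ℝ) + 3 * q / 2) * (n : ℝ) ^ (1 / 2 : ℝ))
        ≤ (n.factorial : ℝ) * (M * coeff n (pathSeries ^ (3 * q + 1))) /
          ((n : ℝ) ^ ((n : ℝ) + 3 * q / 2) * (n : ℝ) ^ (1 / 2 : ℝ)) := by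
          gcongr
          exact hM n
      _ = _ := by field_simp
  have h6 := (h1.const_mul (leadingConstant q)).add h3
  rw [add_zero] at h6
  refine h6.congr fun n => ?_
  rw [hR, map_sub, PowerSeries.coeff_smul, smul_eq_mul]
  ring

theorem excessConstant_natCast (q : ℕ) : excessConstant q = leadingConstant q *
    (Real.sqrt (2 * Real.pi) /
      ((2 : ℝ) ^ ((3 * q + 2 : ℝ) / 2) * Real.Gamma ((3 * q + 2 : ℝ) / 2))) := by
  rw [excessConstant, if_neg (by omega), leadingConstant]
  rcases Nat.eq_zero_or_pos q with rfl | hq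
  · rw [if_pos (by simp), if_pos rfl]
    norm_num
    ring
  · rw [if_neg (by omega), if_neg hq.ne']
    have hq' : (0 : ℝ) < q := by exact_mod_cast hq
    rw [show (3 * q + 2 : ℝ) / 2 = 3 * q / 2 + 1 by ring, Real.Gamma_add_one (by positivity),
      Real.rpow_add_one (by norm_num), Int.toNat_natCast, Int.cast_natCast]
    have := Real.Gamma_pos_of_pos (show 0 < 3 * (q : ℝ) / 2 by positivity)
    have h2 : (0 : ℝ) < 2 ^ (3 * (q : ℝ) / 2) := by positivity
    field_simp

theorem excessConstant_natCast_pos (q : ℕ) : 0 < excessConstant q := by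
  rw [excessConstant_natCast]
  have := Real.Gamma_pos_of_pos (show 0 < (3 * (q : ℝ) + 2) / 2 by positivity)
  have := leadingConstant_pos q
  have := Real.pi_pos
  positivity

theorem isEquivalent_of_excess_nonneg (q : ℕ) :
    (fun n : ℕ => connectedMultigraphNumber (n + q) n) ~[atTop]
      (fun n : ℕ => excessConstant q * (n : ℝ) ^ ((n : ℝ) + (3 * (q : ℝ) - 1) / 2)) := by
  have hK := excessConstant_natCast_pos q
  have h := tendsto_coeff_eulerOp_excessSeries q
  rw [← excessConstant_natCast] at h
  have h1 := h.div_const (excessConstant q)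
  rw [div_self hK.ne'] at h1
  refine isEquivalent_of_tendsto_one (h1.congr' ?_)
  filter_upwards [eventually_ge_atTop 1] with n hn
  have hn0 : (0 : ℝ) < n := by exact_mod_cast hn
  have h5 : (n : ℝ) ^ ((n : ℝ) + (3 * q + 1) / 2) =
      (n : ℝ) ^ ((n : ℝ) + (3 * q - 1) / 2) * n := by
    rw [← Real.rpow_add_one hn0.ne']
    congr 1
    ring
  rw [Pi.div_apply, coeff_eulerOp, coeff_excessSeries, h5, show n + (q + 1) - 1 = n + q by omega]
  have hF := Nat.factorial_pos n
  have hp : (0 : ℝ) < (n : ℝ) ^ ((n : ℝ) + (3 * q - 1) / 2) := by positivity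
  field_simp

/-- Cayley's formula. -/
theorem connectedMultigraphNumber_tree {n : ℕ} (hn : 2 ≤ n) :
    connectedMultigraphNumber (n - 1) n = (n : ℝ) ^ (n - 2) := by
  have h := coeff_rootedTreeSeries (n := n) (by omega)
  rw [rootedTreeSeries, coeff_eulerOp, coeff_excessSeries, add_zero,
    show n - 1 = n - 2 + 1 by omega, pow_succ] at h
  rw [show n - 1 = n - 2 + 1 by omega]
  have hn0 : (0 : ℝ) < n := by positivity
  have hF := Nat.factorial_pos n
  field_simp at h
  exact h

theorem mainTheorem6 (r : ℤ) (hr : -1 ≤ r) :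
    (fun n : ℕ => connectedMultigraphNumber ((n : ℤ) + r).toNat n) ~[atTop]
      (fun n : ℕ => excessConstant r * (n : ℝ) ^ ((n : ℝ) + (3 * (r : ℝ) - 1) / 2)) := by
  rcases hr.eq_or_lt with rfl | hr
  · refine EventuallyEq.isEquivalent ?_
    filter_upwards [eventually_ge_atTop 2] with n hn
    rw [show ((n : ℤ) + -1).toNat = n - 1 by omega, connectedMultigraphNumber_tree hn,
      excessConstant, if_pos rfl, one_mul, ← Real.rpow_natCast, Nat.cast_sub hn]
    congr 1
    norm_num
    ring
  · obtain ⟨q, rfl⟩ := Int.eq_ofNat_of_zero_le (show 0 ≤ r by omega)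
    refine (isEquivalent_of_excess_nonneg q).congr_left (Eventually.of_forall fun n => ?_)
    have h : ((n : ℤ) + Int.ofNat q).toNat = n + q := by
      rw [Int.ofNat_eq_natCast]
      omega
    exact congrArg (connectedMultigraphNumber · n) h.symm
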